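/- Let $G=(V,E)$ be a finite simple graph with $V=\{0,\dots,n-1\}$ and nonnegative real edge weights $w$, and let $\mathcal M_1,\mathcal M_2$ be matroids with ground set $V$, accessible only through independence oracles. For $S\subseteq V$ let $E_G(S)$ be the total weight of the edges having at least one endpoint in $S$, and call $S$ feasible if it is independent in both $\mathcal M_1$ and $\mathcal M_2$. Let $p\ge 1$ be an integer. Local search on a weighted graph with a feasibility oracle uses the potential $g(S)=\sum_{e}\alpha_{\#(e,S)}w(e)$, where $\#(e,S)\in\{0,1,2\}$ is the number of endpoints of $e$ in $S$ and $\alpha_0=0$, $\alpha_1=1$, $\alpha_2=3/2$. It starts from the greedy solution (starting from $\emptyset$, as long as some vertex can be added feasibly, add one that maximizes the new value of $g$). While there are $A\subseteq S$ and $B\subseteq V\setminus S$ with $|A|\le 2p+1$ and $|B|\le 2p$ such that $(S\setminus A)\cup B$ is feasible and $g((S\setminus A)\cup B)>(1+\varepsilon)\,g(S)$, it replaces $S$ by $(S\setminus A)\cup B$ for the first such pair in a fixed enumeration. The algorithm: for each $v\in V$ such that $\{v\}$ is feasible, run this local search with $\varepsilon=1/(3n)^2$ on the graph obtained by deleting $v$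 and its incident edges, where $X\subseteq V\setminus\{v\}$ is feasible if $X\cup\{v\}$ is feasible for the original problem, and add $v$ to the set returned. Output a set of largest $E_G$-value among $\emptyset$ and the sets so obtained. Theorem. There is an absolute constant $C$ such that, for all $p\ge1$ and all inputs as above, this algorithm terminates and returns a set $S$ that is independent in both matroids and satisfies $$E_G(S)\;\ge\;\frac23\Bigl(1-\frac1{p+1}\Bigr)E_G(O)\qquad\text{for every common independent set } O,$$ and it uses at most $\max(n,2)^{Cp}$ arithmetic operations (additions, multiplications, comparisons and constants) and at most $\max(n,2)^{Cp}$ matroid oracle calls; that is, $n^{O(p)}$ of each. -/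

import Mathlib

namespace MatroidCover

/-- Programs over the vertex set `{0, …, n-1}` whose numbers live in a type `R`.  A program can use
numbers only through the arithmetic instructions `const`, `add`, `mul`, `less`, and it can use the two
constraint matroids only through `oracle i X`, which asks whether `X` is independent in the first
(`i = false`) or the second (`i = true`) matroid.  `loop s body` repeats `body` from the state `s`
until it answers `Sum.inl a`, and then returns `a`; `Sum.inr s'` means "continue with `s'`". -/
inductive Prog (n : ℕ) (R : Type) : Type → Type 1
  | ret {α : Type} (a : α) : Prog n R α
  | bind {α β : Type} (x : Prog n R β) (f : β → Prog n R α) : Prog n R α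
  | const (q : ℚ) : Prog n R R
  | add (x y : R) : Prog n R R
  | mul (x y : R) : Prog n R R
  | less (x y : R) : Prog n R Bool
  | oracle (i : Bool) (X : Finset (Fin n)) : Prog n R Bool
  | loop {α σ : Type} (s : σ) (body : σ → Prog n R (α ⊕ σ)) : Prog n R α

instance (n : ℕ) (R : Type) : Monad (Prog n R) where
  pure := Prog.ret
  bind := Prog.bind

/-- A value together with the number of arithmetic operations (comparisons and constants included)
and the number of matroid oracle calls spent on it. -/
structure Counted (α : Type) where
  val : α
  ops : ℕ
  calls : ℕ

/-- One round of a loop, accumulating the counts; `PFun.fix` stops at the first `Sum.inl`. -/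
def loopStep {α σ : Type} (body : σ → Part (Counted (α ⊕ σ))) :
    Counted σ →. Counted α ⊕ Counted σ :=
  fun st => (body st.val).map fun r =>
    match r.val with
    | Sum.inl a => Sum.inl ⟨a, st.ops + r.ops, st.calls + r.calls⟩
    | Sum.inr s' => Sum.inr ⟨s', st.ops + r.ops, st.calls + r.calls⟩

open Classical in
/-- Execution over the real numbers, with oracle access to the matroids `M₁` and `M₂`.
The result is undefined exactly if the execution does not terminate. -/
noncomputable def Prog.run {n : ℕ} (M₁ M₂ : Matroid (Fin n)) :
    {α : Type} → Prog n ℝ α → Part (Counted α)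
  | _, .ret a => Part.some ⟨a, 0, 0⟩
  | _, .bind x f => (x.run M₁ M₂).bind fun r => ((f r.val).run M₁ M₂).map fun r' =>
      ⟨r'.val, r.ops + r'.ops, r.calls + r'.calls⟩
  | _, .const q => Part.some ⟨(q : ℝ), 1, 0⟩
  | _, .add x y => Part.some ⟨x + y, 1, 0⟩
  | _, .mul x y => Part.some ⟨x * y, 1, 0⟩
  | _, .less x y => Part.some ⟨decide (x < y), 1, 0⟩
  | _, .oracle i X => Part.some ⟨decide ((if i then M₂ else M₁).Indep (X : Set (Fin n))), 0, 1⟩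
  | _, .loop s body =>
      PFun.fix (loopStep fun s' => (body s').run M₁ M₂) ⟨s, 0, 0⟩

/-- The total weight of the edges of `G` that have at least one endpoint in `S`. -/
noncomputable def coveredWeight {n : ℕ} (G : SimpleGraph (Fin n)) [DecidableRel G.Adj]
    (w : Sym2 (Fin n) → ℝ) (S : Finset (Fin n)) : ℝ :=
  ∑ e ∈ G.edgeFinset with ∃ v ∈ S, v ∈ e, w e

section Algorithm

variable {n : ℕ} {R : Type}

/-- The number of endpoints of the edge `e` that lie in `X`. -/
def endpointsIn (e : Fin n × Fin n) (X : Finset (Fin n)) : ℕ :=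
  (if e.1 ∈ X then 1 else 0) + (if e.2 ∈ X then 1 else 0)

/-- Every edge of `G`, listed once, as the pair of its endpoints in increasing order. -/
def edgeList (G : SimpleGraph (Fin n)) [DecidableRel G.Adj] : List (Fin n × Fin n) :=
  ((List.finRange n).product (List.finRange n)).filter fun e => e.1 < e.2 ∧ G.Adj e.1 e.2

/-- Computes `∑ e, a (number of endpoints of e in X) * w e` over the listed edges. -/
def edgeSum (a : ℕ → ℚ) (w : Sym2 (Fin n) → R) (edges : List (Fin n × Fin n))
    (X : Finset (Fin n)) : Prog n R R := do
  let zero ← Prog.const 0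
  edges.foldlM (fun acc e => do
    let c ← Prog.const (a (endpointsIn e X))
    let t ← Prog.mul c (w s(e.1, e.2))
    Prog.add acc t) zero

/-- The coefficients of the objective: a covered edge counts once. -/
def coverCoeff : ℕ → ℚ
  | 0 => 0
  | _ => 1

/-- The coefficients `0, 1, 3/2` of the potential function that guides the local search. -/
def potentialCoeff : ℕ → ℚ
  | 0 => 0
  | 1 => 1
  | _ => 3 / 2

/-- Asks both oracles whether `X` is a common independent set. -/
def commonIndep (X : Finset (Fin n)) : Prog n R Bool := do
  let b₁ ← Prog.oracle false X
  let b₂ ← Prog.oracle true X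
  pure (b₁ && b₂)

/-- The greedy algorithm for the function `g`: starting from `∅`, as long as some listed vertex can be
added without losing feasibility, add one for which the new value of `g` is largest. -/
def greedy (feasible : Finset (Fin n) → Prog n R Bool) (g : Finset (Fin n) → Prog n R R)
    (verts : List (Fin n)) : Prog n R (Finset (Fin n)) :=
  Prog.loop (∅ : Finset (Fin n)) fun S => do
    let best ← (verts.filter (· ∉ S)).foldlM (fun (best : Option (Fin n × R)) v => do
      if ← feasible (insert v S) then
        let x ← g (insert v S)
        match best with
        | none => pure (some (v, x))
        | some (_, y) =>
          if ← Prog.less y x then pure (some (v, x)) else pure best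
      else pure best) none
    match best with
    | none => pure (Sum.inl S)
    | some (v, _) => pure (Sum.inr (insert v S))

/-- All sublists of `l` with at most `d` entries. -/
def smallSublists (d : ℕ) (l : List (Fin n)) : List (List (Fin n)) :=
  (List.range (d + 1)).flatMap fun j => l.sublistsLen j

/-- All sets `(S \ A) ∪ B` with `A ⊆ S`, `|A| ≤ 2p + 1`, and `B` a set of listed vertices outside `S`
with `|B| ≤ 2p`. -/
def exchanges (p : ℕ) (verts : List (Fin n)) (S : Finset (Fin n)) : List (Finset (Fin n)) :=
  (smallSublists (2 * p + 1) (verts.filter (· ∈ S))).flatMap fun A =>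
    (smallSublists (2 * p) (verts.filter (· ∉ S))).map fun B =>
      (S \ A.toFinset) ∪ B.toFinset

/-- Local search for the function `g`: start from the greedy solution, and while some exchange leads
to a feasible set `X` with `g X > (1 + ε) * g S`, replace `S` by the first such `X`. -/
def localSearch (p : ℕ) (ε : ℚ) (feasible : Finset (Fin n) → Prog n R Bool)
    (g : Finset (Fin n) → Prog n R R) (verts : List (Fin n)) : Prog n R (Finset (Fin n)) := do
  let S₀ ← greedy feasible g verts
  Prog.loop S₀ fun S => do
    let c ← Prog.const (1 + ε)
    let y ← g S
    let threshold ← Prog.mul c y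
    let found ← (exchanges p verts S).findM? fun X => do
      if ← feasible X then
        let x ← g X
        Prog.less threshold x
      else pure false
    match found with
    | none => pure (Sum.inl S)
    | some X => pure (Sum.inr X)

/-- Local search with partial enumeration: for every vertex `v` such that `{v}` is a common
independent set, delete `v` together with its incident edges, contract `v` in both matroids, run
the local search with `ε = 1/(3n)²`, and add `v` to the outcome.  Among the sets obtained, return one
that covers the largest total weight. -/
def twoMatroidSearch (p : ℕ) (G : SimpleGraph (Fin n)) [DecidableRel G.Adj]
    (w : Sym2 (Fin n) → R) : Prog n R (Finset (Fin n)) :=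
  (List.finRange n).foldlM (fun best v => do
    if ← commonIndep {v} then
      let edges := (edgeList G).filter fun e => e.1 ≠ v ∧ e.2 ≠ v
      let T ← localSearch p (1 / (3 * (n : ℚ)) ^ 2) (fun X => commonIndep (insert v X))
        (edgeSum potentialCoeff w edges) ((List.finRange n).filter (· ≠ v))
      let cur := insert v T
      let x ← edgeSum coverCoeff w (edgeList G) best
      let y ← edgeSum coverCoeff w (edgeList G) cur
      if ← Prog.less x y then pure cur else pure best
    else pure best) ∅

end Algorithm

end MatroidCover

/-! The first ingredient is an exchange theorem for modular weights, `sum_le_of_exchange_le`.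
Suppose that no feasible exchange with at most q elements entering and q + 1 leaving has entering
weight above leaving weight. Then J \ I weighs at most 1 + 1/q times as much as I \ J. Each matroid
provides a matching between entering and leaving elements (`exists_exchange_matching`), and the two
matchings together form closed alternating walks. If the inequality failed, some shortest closed
walk would have positive weight. Chords would cut off shorter walks, which are nonpositive, so the
walk's matchings are the only ones on its index set for either matroid. Hence any portion of it can
be exchanged at once in both matroids (`indep_of_unique_matching`). Windows of q consecutive
entering elements, together with the q + 1 leaving elements around them, are therefore legal
exchanges, and averaging over all windows contradicts positivity.

The second ingredient is a linearization of the potential. Every edge distributes its gain or loss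
over its endpoints with fixed coefficients. The linear estimate never overstates the change of the
potential for a partial exchange (`edge_exchange_bound`), while the full exchange from I to J
compares the covered weights with factor 3/2 (`edge_cover_bound`). Together with the exchange
theorem this gives the ratio, up to an additive error of n times ε times the potential.

That error is absorbed by the guessed vertex v. For the v in O that covers most, v alone covers at
least a 1/n fraction of what O covers, and its own share is obtained with ratio 1 instead of 3/2
(`approximation_arithmetic`).

For the running time, the greedy value is within a factor n of every feasible value and each
improvement multiplies the potential by more than 1 + ε. So there are O(n³) rounds, each scanning
polynomially many exchanges for fixed p (`spec_localSearch`, `running_time_bound`). -/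

namespace MatroidCover

/-! ### Shortest positive closed walks and uniqueness of their matchings. -/

section Walks

variable {α β : Type*}

/-- A closed walk of length `m` that alternates between `β` and `α`: each `b i` is joined to `a i` by
`R₂` and to `a (i + 1)` by `R₁`. -/
structure IsClosedWalk (R₁ R₂ : β → α → Prop) {m : ℕ} (b : ZMod m → β) (a : ZMod m → α) : Prop where
  next : ∀ i, R₁ (b i) (a (i + 1))
  same : ∀ i, R₂ (b i) (a i)

/-- No closed walk that is shorter than `m` has positive weight. -/
def NoShorterPositive (R₁ R₂ : β → α → Prop) (z : β → ℝ) (y : α → ℝ) (m : ℕ) : Prop :=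
  ∀ (L : ℕ) [NeZero L], L < m → ∀ (b : ZMod L → β) (a : ZMod L → α), IsClosedWalk R₁ R₂ b a →
    ∑ i, (z (b i) - y (a i)) ≤ 0

theorem sum_zmod_val {L : ℕ} [NeZero L] (f : ℕ → ℝ) :
    ∑ i : ZMod L, f i.val = ∑ k ∈ Finset.range L, f k := by
  refine Finset.sum_nbij' (fun i => i.val) (fun k => (k : ZMod L)) ?_ ?_ ?_ ?_ ?_
  · intro i _; simpa using ZMod.val_lt i
  · intro k _; simp
  · intro i _; simp
  · intro k hk; exact ZMod.val_cast_of_lt (by simpa using hk)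
  · intro i _; rfl

theorem sum_range_zmod {m : ℕ} [NeZero m] (c : ZMod m → ℝ) (s : ZMod m) :
    ∑ k ∈ Finset.range m, c (s + (k : ZMod m)) = ∑ i, c i := by
  rw [← sum_zmod_val (fun k => c (s + (k : ZMod m)))]
  simpa using Equiv.sum_comp (Equiv.addLeft s) c

variable {R₁ R₂ : β → α → Prop} {z : β → ℝ} {y : α → ℝ} {m : ℕ} {b : ZMod m → β} {a : ZMod m → α}

/-- The chord closes the arc of L + 1 consecutive indices into a closed walk shorter than m, to
which minimality applies. -/
theorem IsClosedWalk.interval_nonpos (hw : IsClosedWalk R₁ R₂ b a)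
    (hmin : NoShorterPositive R₁ R₂ z y m) (j : ZMod m) (L : ℕ) (hLm : L + 1 < m)
    (hR : R₁ (b (j + (L : ZMod m))) (a j)) :
    ∑ k ∈ Finset.range (L + 1), (z (b (j + (k : ZMod m))) - y (a (j + (k : ZMod m)))) ≤ 0 := by
  have := hmin (L + 1) hLm (fun k => b (j + (k.val : ZMod m))) (fun k => a (j + (k.val : ZMod m)))
    ⟨fun k => ?_, fun k => hw.same _⟩
  · rwa [sum_zmod_val (fun k => z (b (j + (k : ZMod m))) - y (a (j + (k : ZMod m))))] at this
  · by_cases hk : k.val = L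
    · have h0 : k + 1 = 0 := by
        have : k = (L : ZMod (L + 1)) := (ZMod.natCast_zmod_val k).symm.trans (by rw [hk])
        rw [this]
        exact_mod_cast ZMod.natCast_self (L + 1)
      simpa [h0, hk] using hR
    · have hlt : k.val + 1 < L + 1 := by have := ZMod.val_lt k; omega
      have h1 : (k + 1).val = k.val + 1 := by
        have : k + 1 = ((k.val + 1 : ℕ) : ZMod (L + 1)) := by push_cast; simp
        rw [this, ZMod.val_cast_of_lt hlt]
      rw [h1]
      push_cast
      rw [← add_assoc]
      exact hw.next _

/-- In a shortest closed walk of positive weight, the successor map is the only permutation that is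
compatible with `R₁`. -/
theorem IsClosedWalk.perm_eq_succ [NeZero m] (hw : IsClosedWalk R₁ R₂ b a)
    (hmin : NoShorterPositive R₁ R₂ z y m) (hpos : 0 < ∑ i, (z (b i) - y (a i)))
    (τ : Equiv.Perm (ZMod m)) (hτ : ∀ i, R₁ (b i) (a (τ i))) (i₀ : ZMod m) : τ i₀ = i₀ + 1 := by
  by_contra hne
  set c : ZMod m → ℝ := fun i => z (b i) - y (a i) with hc
  set T := ∑ i, c i with hT
  -- The cycle is cut just before i₀ + 1. The only arc of full length m, which minimality does not
  -- control, would be closed by τ i₀ = i₀ + 1, and this is excluded.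
  set s := i₀ + 1 with hs
  set Φ : ℕ → ℝ := fun t => ∑ k ∈ Finset.range t, c (s + (k : ZMod m)) with hΦ
  set pos : ZMod m → ℕ := fun i => (i - s).val with hposdef
  have spos : ∀ i, s + (pos i : ZMod m) = i := fun i => by simp [hposdef]
  have pos_lt : ∀ i, pos i < m := fun i => ZMod.val_lt _
  have Φm : ∀ t, Φ (m + t) = T + Φ t := fun t => by
    simp only [hΦ]
    rw [Finset.sum_range_add, sum_range_zmod]
    simp [hT]
  have Φsub : ∀ t L : ℕ, ∑ k ∈ Finset.range L, c (s + (t : ZMod m) + (k : ZMod m)) = Φ (t + L) - Φ t :=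
    fun t L => by
      simp only [hΦ]
      rw [Finset.sum_range_add]
      simp [add_assoc]
  have Φsucc : ∀ i, Φ (pos i + 1) - Φ (pos i) = c i := fun i => by
    rw [← Φsub]; simp [spos]
  -- Permuting the subtracted prefix sums does not change the total, which is T > 0. The
  -- contradiction comes from showing that every single difference is nonpositive.
  have total : ∑ i, (Φ (pos i + 1) - Φ (pos (τ i))) = T := by
    rw [Finset.sum_sub_distrib, Equiv.sum_comp τ (fun i => Φ (pos i)), ← Finset.sum_sub_distrib]
    exact Finset.sum_congr rfl fun i _ => Φsucc i
  have le0 : ∀ i, Φ (pos i + 1) - Φ (pos (τ i)) ≤ 0 := by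
    intro i
    rcases le_or_gt (pos (τ i)) (pos i) with h | h
    · have hne' : pos i - pos (τ i) + 1 < m := by
        by_contra hcon
        have h1 := pos_lt i
        have h2 : pos i = m - 1 := by omega
        have h3 : pos (τ i) = 0 := by omega
        have h4 : τ i = s := by rw [← spos (τ i), h3]; simp
        have h5 : i = i₀ := by
          rw [← spos i, h2, Nat.cast_sub (by omega)]
          simp [hs]
        exact hne (h5 ▸ h4)
      have := hw.interval_nonpos hmin (τ i) (pos i - pos (τ i)) hne' (by
        have : τ i + ((pos i - pos (τ i) : ℕ) : ZMod m) = i := by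
          rw [Nat.cast_sub h]
          linear_combination spos i - spos (τ i)
        rw [this]; exact hτ i)
      have h6 := Φsub (pos (τ i)) (pos i - pos (τ i) + 1)
      rw [spos] at h6
      rw [show pos i + 1 = pos (τ i) + (pos i - pos (τ i) + 1) by omega, ← h6]
      exact this
    -- An arc that wraps past the cut has sum equal to the difference plus T, so T > 0 only helps.
    -- If τ i is the successor of i, the difference is zero.
    · rcases Nat.lt_or_ge (pos i + 1) (pos (τ i)) with h' | h'
      · have h1 := pos_lt (τ i)
        have := hw.interval_nonpos hmin (τ i) (m + pos i - pos (τ i)) (by omega) (by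
          have : τ i + ((m + pos i - pos (τ i) : ℕ) : ZMod m) = i := by
            rw [Nat.cast_sub (by omega)]
            push_cast
            simp only [CharP.cast_eq_zero, zero_add]
            linear_combination spos i - spos (τ i)
          rw [this]; exact hτ i)
        have h6 := Φsub (pos (τ i)) (m + pos i - pos (τ i) + 1)
        rw [spos, show pos (τ i) + (m + pos i - pos (τ i) + 1) = m + (pos i + 1) by omega, Φm] at h6
        have h7 : T + Φ (pos i + 1) - Φ (pos (τ i)) ≤ 0 := h6 ▸ this
        linarith
      · rw [show pos (τ i) = pos i + 1 by omega]; simp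
  have := Finset.sum_nonpos fun i (_ : i ∈ Finset.univ) => le0 i
  linarith

/-- The closed walk traversed backwards, with the roles of `R₁` and `R₂` exchanged. -/
theorem IsClosedWalk.reverse (hw : IsClosedWalk R₁ R₂ b a) :
    IsClosedWalk R₂ R₁ (fun i => b (-i)) (fun i => a (1 - i)) where
  next i := by simpa using hw.same (-i)
  same i := by simpa [sub_eq_neg_add] using hw.next (-i)

theorem sum_reverse [NeZero m] (z : β → ℝ) (y : α → ℝ) (b : ZMod m → β) (a : ZMod m → α) :
    ∑ i, (z (b (-i)) - y (a (1 - i))) = ∑ i, (z (b i) - y (a i)) := by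
  rw [Finset.sum_sub_distrib, Finset.sum_sub_distrib]
  congr 1
  · exact Equiv.sum_comp (Equiv.neg _) fun i => z (b i)
  · exact Equiv.sum_comp (Equiv.subLeft 1) fun i => y (a i)

theorem NoShorterPositive.symm (hmin : NoShorterPositive R₁ R₂ z y m) :
    NoShorterPositive R₂ R₁ z y m := fun L _ hL b a hw => by
  rw [← sum_reverse]
  exact hmin L hL _ _ hw.reverse

/-- In a shortest closed walk of positive weight, the identity is the only permutation that is
compatible with `R₂`. -/
theorem IsClosedWalk.perm_eq_id [NeZero m] (hw : IsClosedWalk R₁ R₂ b a)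
    (hmin : NoShorterPositive R₁ R₂ z y m) (hpos : 0 < ∑ i, (z (b i) - y (a i)))
    (τ : Equiv.Perm (ZMod m)) (hτ : ∀ i, R₂ (b i) (a (τ i))) (i : ZMod m) : τ i = i := by
  -- Transported to the reversed walk, τ is compatible with the relation that plays the first role
  -- there, and being the successor map there means being the identity here.
  have := hw.reverse.perm_eq_succ hmin.symm (by rwa [sum_reverse])
    (((Equiv.neg _).trans τ).trans (Equiv.subLeft 1)) (fun i => by simpa using hτ (-i)) (-i)
  simp at this
  linear_combination -this

/-- If two indices carried the same element, their transposition would be a second permutation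
compatible with `R₂`. -/
theorem IsClosedWalk.injective_left [NeZero m] (hw : IsClosedWalk R₁ R₂ b a)
    (hmin : NoShorterPositive R₁ R₂ z y m) (hpos : 0 < ∑ i, (z (b i) - y (a i))) :
    Function.Injective b := by
  intro i j hij
  by_contra hne
  have := hw.perm_eq_id hmin hpos (Equiv.swap i j) (fun k => ?_) i
  · simp [Equiv.swap_apply_left] at this
    exact hne this.symm
  · by_cases h1 : k = i
    · subst h1; rw [Equiv.swap_apply_left, hij]; exact hw.same _
    · by_cases h2 : k = j
      · subst h2; rw [Equiv.swap_apply_right, ← hij]; exact hw.same _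
      · rw [Equiv.swap_apply_of_ne_of_ne h1 h2]; exact hw.same _

theorem IsClosedWalk.injective_right [NeZero m] (hw : IsClosedWalk R₁ R₂ b a)
    (hmin : NoShorterPositive R₁ R₂ z y m) (hpos : 0 < ∑ i, (z (b i) - y (a i))) :
    Function.Injective a := by
  intro i j hij
  by_contra hne
  have := hw.perm_eq_id hmin hpos (Equiv.swap i j) (fun k => ?_) i
  · simp [Equiv.swap_apply_left] at this
    exact hne this.symm
  · by_cases h1 : k = i
    · subst h1; rw [Equiv.swap_apply_left, ← hij]; exact hw.same _
    · by_cases h2 : k = j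
      · subst h2; rw [Equiv.swap_apply_right, hij]; exact hw.same _
      · rw [Equiv.swap_apply_of_ne_of_ne h1 h2]; exact hw.same _

/-- If the identity is the only permutation compatible with the relation `E`, then every nonempty
finite set has an element without an `E`-successor in it other than itself. -/
theorem exists_sink {ι : Type*} [Finite ι] {E : ι → ι → Prop} (hE : ∀ i, E i i)
    (huniq : ∀ τ : Equiv.Perm ι, (∀ i, E i (τ i)) → ∀ i, τ i = i) {X : Finset ι}
    (hX : X.Nonempty) : ∃ i ∈ X, ∀ j ∈ X, j ≠ i → ¬ E i j := by
  classical
  by_contra! hcon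
  choose! f hf using hcon
  -- Without a sink, following successors inside the finite set runs into a cycle. On periodic
  -- points f is injective, so extending it by the identity gives a compatible permutation that
  -- moves something.
  set P : Set ι := {i ∈ (X : Set ι) | i ∈ Function.periodicPts f} with hP
  have hmaps : ∀ i ∈ P, f i ∈ P := fun i hi =>
    ⟨(hf i hi.1).1, (Function.bijOn_periodicPts f).mapsTo hi.2⟩
  set g : ι → ι := fun i => if i ∈ P then f i else i with hg
  have ginj : Function.Injective g := by
    intro i j hij
    by_cases hi : i ∈ P <;> by_cases hj : j ∈ P <;> simp only [hg, hi, hj, if_true, if_false] at hij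
    · exact (Function.bijOn_periodicPts f).injOn hi.2 hj.2 hij
    · exact absurd (hij ▸ hmaps i hi) hj
    · exact absurd (hij ▸ hmaps j hj) hi
    · exact hij
  obtain ⟨i, hi⟩ : P.Nonempty := by
    obtain ⟨x, hx⟩ := hX
    have hit : ∀ k, f^[k] x ∈ X := fun k => by
      induction k with
      | zero => exact hx
      | succ k ih => rw [Function.iterate_succ_apply']; exact (hf _ ih).1
    obtain ⟨k, l, hkl, h⟩ := Finite.exists_ne_map_eq_of_infinite fun k : ℕ => f^[k] x
    wlog hlt : k < l generalizing k l
    · exact this l k hkl.symm h.symm (by omega)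
    refine ⟨f^[k] x, hit k, Function.mk_mem_periodicPts (n := l - k) (by omega) ?_⟩
    change f^[l - k] (f^[k] x) = f^[k] x
    rw [← Function.iterate_add_apply, Nat.sub_add_cancel hlt.le]
    exact h.symm
  have := huniq (Equiv.ofBijective g (Finite.injective_iff_bijective.1 ginj)) (fun j => by
    simp only [Equiv.ofBijective_apply, hg]
    split_ifs with hj
    · exact (hf j hj.1).2.2
    · exact hE j) i
  simp only [Equiv.ofBijective_apply, hg, hi, if_true] at this
  exact (hf i hi.1).2.1 this

/-- Two perfect matchings of positive total weight contain a closed walk of positive weight. -/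
theorem exists_shortest_positive [Fintype α] [Fintype β] {N₁ N₂ : β ≃ α}
    (h₁ : ∀ x, R₁ x (N₁ x)) (h₂ : ∀ x, R₂ x (N₂ x)) (hpos : ∑ x, y x < ∑ x, z x) :
    ∃ (m : ℕ) (_ : NeZero m) (b : ZMod m → β) (a : ZMod m → α), IsClosedWalk R₁ R₂ b a ∧
      0 < ∑ i, (z (b i) - y (a i)) ∧ NoShorterPositive R₁ R₂ z y m := by
  classical
  have hex : ∃ m : ℕ, ∃ (_ : NeZero m) (b : ZMod m → β) (a : ZMod m → α), IsClosedWalk R₁ R₂ b a ∧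
      0 < ∑ i, (z (b i) - y (a i)) := by
    -- Every starting point is followed for `orderOf σ` steps, whatever its own orbit length. The
    -- sums over all starting points then add up to a multiple of the total weight, so one of them
    -- is positive.
    set σ : Equiv.Perm β := N₁.trans N₂.symm with hσ
    have hL : 0 < orderOf σ := orderOf_pos σ
    have : NeZero (orderOf σ) := ⟨hL.ne'⟩
    have hsum : ∑ x, ∑ k ∈ Finset.range (orderOf σ), (z ((σ ^ k) x) - y (N₂ ((σ ^ k) x))) =
        orderOf σ * (∑ x, z x - ∑ x, y x) := by
      rw [Finset.sum_comm]
      rw [Finset.sum_congr rfl (fun k _ =>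
        Equiv.sum_comp (σ ^ k) fun x => z x - y (N₂ x))]
      rw [Finset.sum_const, Finset.card_range, nsmul_eq_mul, Finset.sum_sub_distrib,
        Equiv.sum_comp N₂ y]
    obtain ⟨x, -, hx⟩ : ∃ x ∈ Finset.univ,
        0 < ∑ k ∈ Finset.range (orderOf σ), (z ((σ ^ k) x) - y (N₂ ((σ ^ k) x))) := by
      apply Finset.exists_lt_of_sum_lt
      rw [Finset.sum_const_zero, hsum]
      have : (0 : ℝ) < orderOf σ := by exact_mod_cast hL
      exact mul_pos this (by linarith)
    refine ⟨orderOf σ, inferInstance, fun i => (σ ^ i.val) x, fun i => N₂ ((σ ^ i.val) x),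
      ⟨fun i => ?_, fun i => h₂ _⟩, ?_⟩
    · have : σ ^ (i + 1).val = σ * σ ^ i.val := by
        rw [← pow_succ', pow_eq_pow_iff_modEq, ← ZMod.natCast_eq_natCast_iff]
        simp
      rw [this]
      simpa [hσ] using h₁ ((σ ^ i.val) x)
    · rwa [sum_zmod_val fun k => z ((σ ^ k) x) - y (N₂ ((σ ^ k) x))]
  obtain ⟨hne, b, a, hw, hp⟩ := Nat.find_spec hex
  refine ⟨Nat.find hex, hne, b, a, hw, hp, fun L hL hlt b' a' hw' => ?_⟩
  by_contra hcon
  exact Nat.find_min hex hlt ⟨hL, b', a', hw', not_le.1 hcon⟩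

end Walks

end MatroidCover
namespace MatroidCover

/-! ### Matroid exchanges along matchings and the modular local optimality bound. -/

section Exchange

variable {V : Type*}

/-- The exchange relation of a matroid at the independent set `K`, padded with dummies so that sets of
different sizes can be matched: `b` is joined to the elements of its fundamental circuit if it is not in
`K` and to all dummies if it is, and a dummy on the left is joined to everything. -/
def exchangeRel (M : Matroid V) (K : Set V) (B A : Finset V) :
    {v // v ∈ B} ⊕ {v // v ∈ A} → {v // v ∈ A} ⊕ {v // v ∈ B} → Prop
  | Sum.inl b, Sum.inl a => (b : V) ∈ M.closure K ∧ (b : V) ∉ K ∧ (a : V) ∈ M.fundCircuit b K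
  | Sum.inl b, Sum.inr _ => (b : V) ∈ K
  | Sum.inr _, _ => True

/-- This is Hall's condition. The fundamental circuit of each element of s lies, apart from that
element, in Γ ∪ (K ∩ J), so this set spans s ∪ (K ∩ J), which is independent as a subset of J.
Comparing ranks and cancelling K ∩ J gives the bound. -/
theorem card_le_card_circuit_neighbours [DecidableEq V] {M : Matroid V} {J K : Finset V}
    (hJ : M.Indep J) (hK : M.Indep K) (hJK : (J : Set V) ⊆ M.closure K) {s Γ : Finset V}
    (hs : s ⊆ J \ K) (hΓ : ∀ b ∈ s, ∀ x ∈ M.fundCircuit b K, x ∈ K → x ∉ J → x ∈ Γ) :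
    s.card ≤ Γ.card := by
  have hsub : ((s ∪ (K ∩ J) : Finset V) : Set V) ⊆ J := by
    intro x hx
    simp only [Finset.coe_union, Set.mem_union, Finset.mem_coe, Finset.mem_inter] at hx
    rcases hx with hx | hx
    · exact (Finset.mem_sdiff.1 (hs hx)).1
    · exact hx.2
  have hcl : ((s ∪ (K ∩ J) : Finset V) : Set V) ⊆ M.closure ((Γ ∪ (K ∩ J) : Finset V) : Set V) := by
    have hKJ : ((K ∩ J : Finset V) : Set V) ⊆
        M.closure ((Γ ∪ (K ∩ J) : Finset V) : Set V) := by
      refine subset_trans ?_ (M.closure_subset_closure (X := ((K ∩ J : Finset V) : Set V)) (by simp))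
      exact M.subset_closure _ (hK.subset (by simp)).subset_ground
    intro x hx
    simp only [Finset.coe_union, Set.mem_union] at hx
    rcases hx with hx | hx
    · have hxs := Finset.mem_sdiff.1 (hs hx)
      have hC := hK.fundCircuit_isCircuit (hJK hxs.1) (by simpa using hxs.2)
      have h1 := hC.mem_closure_sdiff_singleton_of_mem (M.mem_fundCircuit x K)
      refine M.closure_subset_closure ?_ h1
      intro u hu
      have huK : u ∈ K := by
        have := M.fundCircuit_subset_insert x K hu.1
        rcases this with h | h
        · exact absurd h hu.2
        · simpa using h
      by_cases huJ : u ∈ J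
      · simp [huK, huJ]
      · simp [hΓ x hx u hu.1 huK huJ]
    · exact hKJ hx
  have h1 := (hJ.subset hsub).encard_le_eRk_of_subset hcl
  rw [M.eRk_closure_eq] at h1
  have h2 := h1.trans (M.eRk_le_encard _)
  rw [Set.encard_coe_eq_coe_finsetCard, Set.encard_coe_eq_coe_finsetCard] at h2
  have h3 : (s ∪ (K ∩ J)).card ≤ (Γ ∪ (K ∩ J)).card := by exact_mod_cast h2
  rw [Finset.card_union_of_disjoint] at h3
  · have := Finset.card_union_le Γ (K ∩ J); omega
  · rw [Finset.disjoint_left]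
    intro x hx hx'
    exact (Finset.mem_sdiff.1 (hs hx)).2 (Finset.mem_inter.1 hx').1

/-- Two independent sets have a perfect matching in the padded exchange relation. -/
theorem exists_exchange_matching [DecidableEq V] (M : Matroid V) {I J : Finset V}
    (hI : M.Indep I) (hJ : M.Indep J) :
    ∃ K : Set V, (I : Set V) ⊆ K ∧ M.Indep K ∧
      ∃ N : {v // v ∈ J \ I} ⊕ {v // v ∈ I \ J} ≃ {v // v ∈ I \ J} ⊕ {v // v ∈ J \ I},
        ∀ x, exchangeRel M K (J \ I) (I \ J) x (N x) := by
  classical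
  -- Passing from I to a basis K of I ∪ J puts every element of J in the closure. Elements of J in K
  -- \ I enter for free and are matched with dummies; those outside K have fundamental circuits, and
  -- Hall's theorem applies.
  obtain ⟨K, hKb, hIK⟩ := hI.subset_isBasis_of_subset (X := (I : Set V) ∪ J) (by simp)
    (Set.union_subset hI.subset_ground hJ.subset_ground)
  have hKfin : K.Finite := ((I.finite_toSet).union J.finite_toSet).subset hKb.subset
  obtain ⟨K, rfl⟩ := hKfin.exists_finset_coe
  refine ⟨K, hIK, hKb.indep, ?_⟩
  have hJK : (J : Set V) ⊆ M.closure K := Set.subset_union_right.trans hKb.subset_closure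
  set t : {v // v ∈ J \ K} → Finset V :=
    fun b => (I \ J).filter (fun a => a ∈ M.fundCircuit b K) with ht
  obtain ⟨f, finj, hf⟩ := (Finset.all_card_le_biUnion_card_iff_exists_injective t).1 (fun s => by
    rw [← Finset.card_map (Function.Embedding.subtype _)]
    refine card_le_card_circuit_neighbours hJ hKb.indep hJK ?_ ?_
    · intro x hx
      simp only [Finset.mem_map, Function.Embedding.subtype_apply] at hx
      obtain ⟨u, -, rfl⟩ := hx
      exact u.2
    · intro b hb x hx hxK hxJ
      simp only [Finset.mem_map, Function.Embedding.subtype_apply] at hb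
      obtain ⟨u, hu, rfl⟩ := hb
      refine Finset.mem_biUnion.2 ⟨u, hu, ?_⟩
      have : x ∈ (I : Set V) ∪ J := hKb.subset (by simpa using hxK)
      simp only [Set.mem_union, Finset.mem_coe, hxJ, or_false] at this
      simp [ht, this, hxJ, hx])
  have hfmem : ∀ b : {v // v ∈ J \ K}, f b ∈ I \ J := fun b => (Finset.mem_filter.1 (hf b)).1
  have hfC : ∀ b : {v // v ∈ J \ K}, f b ∈ M.fundCircuit b K := fun b => (Finset.mem_filter.1 (hf b)).2
  set g : {v // v ∈ J \ I} → {v // v ∈ I \ J} ⊕ {v // v ∈ J \ I} := fun b =>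
    if h : (b : V) ∈ K then Sum.inr b
    else Sum.inl ⟨f ⟨b, Finset.mem_sdiff.2 ⟨(Finset.mem_sdiff.1 b.2).1, h⟩⟩, hfmem _⟩ with hg
  have ginj : Function.Injective g := by
    intro b b' h
    simp only [hg] at h
    split_ifs at h with h1 h2
    · exact Sum.inr.inj h
    · have h3 := finj (congrArg Subtype.val (Sum.inl.inj h))
      exact Subtype.ext (Subtype.mk.inj h3)
  -- Padding makes both sides equally large, and left dummies are joined to everything, so any
  -- bijective extension works. Only the values on `Sum.inl` are prescribed; those on `Sum.inr` are
  -- filler.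
  obtain ⟨e, he⟩ := Finset.exists_equiv_extend_of_card_eq
    (α := {v // v ∈ J \ I} ⊕ {v // v ∈ I \ J}) (t := Finset.univ)
    (by rw [Finset.card_univ, Fintype.card_sum, Fintype.card_sum, add_comm])
    (s := Finset.univ.image Sum.inl) (f := Sum.elim g fun a => Sum.inl a)
    (Finset.subset_univ _) (by
      intro x hx x' hx' h
      simp only [Finset.coe_image, Set.mem_image] at hx hx'
      obtain ⟨u, -, rfl⟩ := hx
      obtain ⟨u', -, rfl⟩ := hx'
      simp only [Sum.elim_inl] at h
      rw [ginj h])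
  refine ⟨e.trans (Equiv.subtypeUnivEquiv fun x => Finset.mem_univ x), fun x => ?_⟩
  rcases x with b | a
  · have h1 := he (Sum.inl b) (by simp)
    have h2 : (e.trans (Equiv.subtypeUnivEquiv fun x => Finset.mem_univ x)) (Sum.inl b) = g b := h1
    rw [h2]
    by_cases h : (b : V) ∈ K
    · simp [hg, h, exchangeRel]
    · simp only [hg, h, dif_neg, not_false_eq_true, exchangeRel]
      exact ⟨hJK (Finset.mem_sdiff.1 b.2).1, by simpa using h, hfC _⟩
  · trivial

/-- A set of exchanges for which the matching is unique can be carried out simultaneously. -/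
theorem indep_of_unique_matching {M : Matroid V} {K : Set V} (hK : M.Indep K) {B A : Finset V}
    (hBA : Disjoint B A) {ι : Type*} [Finite ι] {b : ι → {v // v ∈ B} ⊕ {v // v ∈ A}}
    {a : ι → {v // v ∈ A} ⊕ {v // v ∈ B}} (hb : Function.Injective b)
    (hR : ∀ i, exchangeRel M K B A (b i) (a i))
    (huniq : ∀ τ : Equiv.Perm ι, (∀ i, exchangeRel M K B A (b i) (a (τ i))) → ∀ i, τ i = i)
    (X : Finset ι) :
    M.Indep ((K \ {v | ∃ i ∈ X, ∃ h, a i = Sum.inl ⟨v, h⟩}) ∪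
      {v | ∃ i ∈ X, ∃ h, b i = Sum.inl ⟨v, h⟩}) := by
  classical
  induction X using Finset.strongInduction with
  | H X ih =>
  rcases X.eq_empty_or_nonempty with rfl | hX
  · simpa using hK
  -- The sink is exchanged last. Its fundamental circuit contains none of the elements removed by
  -- the other exchanges, so it is still the fundamental circuit after them and the last swap is
  -- legal.
  obtain ⟨i, hi, hsink⟩ := exists_sink
    (E := fun i j => exchangeRel M K B A (b i) (a j)) hR huniq hX
  have ih' := ih (X.erase i) (Finset.erase_ssubset hi)
  set K' := (K \ {v | ∃ j ∈ X.erase i, ∃ h, a j = Sum.inl ⟨v, h⟩}) ∪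
      {v | ∃ j ∈ X.erase i, ∃ h, b j = Sum.inl ⟨v, h⟩} with hK'
  have hsub : ∀ v, v ∈ (K \ {v | ∃ i ∈ X, ∃ h, a i = Sum.inl ⟨v, h⟩}) ∪
      {v | ∃ i ∈ X, ∃ h, b i = Sum.inl ⟨v, h⟩} → v ∈ K' ∨ ∃ h, b i = Sum.inl ⟨v, h⟩ := by
    rintro v (⟨hv, hn⟩ | ⟨j, hj, h, hjb⟩)
    · refine Or.inl (Or.inl ⟨hv, ?_⟩)
      rintro ⟨j, hj, h⟩
      exact hn ⟨j, Finset.mem_of_mem_erase hj, h⟩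
    · by_cases hji : j = i
      · exact Or.inr ⟨h, hji ▸ hjb⟩
      · exact Or.inl (Or.inr ⟨j, Finset.mem_erase.2 ⟨hji, hj⟩, h, hjb⟩)
  rcases hbi : b i with b₀ | a₀
  · rcases hai : a i with a₁ | b₁
    · have hr := hR i
      rw [hbi, hai] at hr
      obtain ⟨hcl, hbK, haC⟩ := hr
      have hCirc := hK.fundCircuit_isCircuit hcl hbK
      have hCK : M.fundCircuit b₀ K ⊆ insert (b₀ : V) K' := by
        intro v hv
        rcases M.fundCircuit_subset_insert _ _ hv with rfl | hvK
        · exact Set.mem_insert _ _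
        · refine Or.inr (Or.inl ⟨hvK, ?_⟩)
          rintro ⟨j, hj, h, haj⟩
          refine hsink j (Finset.mem_of_mem_erase hj) (Finset.ne_of_mem_erase hj) ?_
          rw [hbi, haj]
          exact ⟨hcl, hbK, hv⟩
      have hbK' : (b₀ : V) ∉ K' := by
        rintro (⟨h, -⟩ | ⟨j, hj, h, hbj⟩)
        · exact hbK h
        · exact Finset.ne_of_mem_erase hj (hb (hbj.trans hbi.symm))
      have hEq := hCirc.eq_fundCircuit_of_subset ih' hCK
      have hbcl : (b₀ : V) ∈ M.closure K' := by
        have h1 := hCirc.mem_closure_sdiff_singleton_of_mem (M.mem_fundCircuit b₀ K)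
        refine M.closure_subset_closure ?_ h1
        intro v hv
        exact (hCK hv.1).resolve_left hv.2
      rw [hEq, ih'.mem_fundCircuit_iff hbcl hbK'] at haC
      refine haC.subset fun v hv => ?_
      have hva : v ≠ (a₁ : V) := by
        rintro rfl
        rcases hv with ⟨-, hn⟩ | ⟨j, hj, h, -⟩
        · exact hn ⟨i, hi, a₁.2, hai⟩
        · exact Finset.disjoint_left.1 hBA h a₁.2
      refine ⟨?_, hva⟩
      rcases hsub v hv with h | ⟨h, hb'⟩
      · exact Or.inr h
      · rw [hbi] at hb'
        exact Or.inl (congrArg Subtype.val (Sum.inl.inj hb')).symm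
    · have hr := hR i
      rw [hbi, hai] at hr
      refine ih'.subset fun v hv => ?_
      rcases hsub v hv with h | ⟨h, hb'⟩
      · exact h
      · rw [hbi] at hb'
        obtain rfl : (b₀ : V) = v := congrArg Subtype.val (Sum.inl.inj hb')
        refine Or.inl ⟨hr, ?_⟩
        rintro ⟨j, -, h', -⟩
        exact Finset.disjoint_left.1 hBA h h'
  · refine ih'.subset fun v hv => ?_
    rcases hsub v hv with h | ⟨h, hb'⟩
    · exact h
    · rw [hbi] at hb'; cases hb'

/-- The elements of `B` in a set of elements and dummies. -/
def realPart {B A : Finset V} (u : Finset ({v // v ∈ B} ⊕ {v // v ∈ A})) : Finset V :=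
  u.toLeft.map (Function.Embedding.subtype _)

theorem mem_realPart {B A : Finset V} {u : Finset ({v // v ∈ B} ⊕ {v // v ∈ A})} {v : V} :
    v ∈ realPart u ↔ ∃ h, Sum.inl ⟨v, h⟩ ∈ u := by
  simp [realPart]

theorem realPart_subset {B A : Finset V} (u : Finset ({v // v ∈ B} ⊕ {v // v ∈ A})) :
    realPart u ⊆ B := fun _ hv => (mem_realPart.1 hv).1

theorem card_realPart_le {B A : Finset V} (u : Finset ({v // v ∈ B} ⊕ {v // v ∈ A})) :
    (realPart u).card ≤ u.card := by
  rw [realPart, Finset.card_map]; exact Finset.card_toLeft_le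

theorem sum_realPart {B A : Finset V} (u : Finset ({v // v ∈ B} ⊕ {v // v ∈ A})) (f : V → ℝ) :
    ∑ v ∈ realPart u, f v =
      ∑ x ∈ u, Sum.elim (fun v : {v // v ∈ B} => f v) (fun _ => 0) x := by
  rw [Finset.sum_sum_eq_sum_toLeft_add_sum_toRight, realPart, Finset.sum_map]
  simp

/-- Local optimality with respect to exchanges of bounded size, for modular weights and two matroids. -/
theorem sum_le_of_exchange_le [DecidableEq V] {M₁ M₂ : Matroid V} {I J : Finset V}
    (hI₁ : M₁.Indep I) (hI₂ : M₂.Indep I) (hJ₁ : M₁.Indep J) (hJ₂ : M₂.Indep J) {q : ℕ} (hq : 1 ≤ q)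
    {z y : V → ℝ} (hy : ∀ v, 0 ≤ y v)
    (hloc : ∀ A ⊆ I \ J, ∀ B ⊆ J \ I, A.card ≤ q + 1 → B.card ≤ q →
      M₁.Indep ((I \ A ∪ B : Finset V) : Set V) → M₂.Indep ((I \ A ∪ B : Finset V) : Set V) →
      ∑ v ∈ B, z v ≤ ∑ v ∈ A, y v) :
    ∑ v ∈ J \ I, z v ≤ (1 + 1 / (q : ℝ)) * ∑ v ∈ I \ J, y v := by
  classical
  by_contra! hcon
  obtain ⟨K₁, hIK₁, hK₁, N₁, hN₁⟩ := exists_exchange_matching M₁ hI₁ hJ₁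
  obtain ⟨K₂, hIK₂, hK₂, N₂, hN₂⟩ := exists_exchange_matching M₂ hI₂ hJ₂
  have hq0 : (0 : ℝ) < q := by exact_mod_cast hq
  set z' : {v // v ∈ J \ I} ⊕ {v // v ∈ I \ J} → ℝ := Sum.elim (fun v => z v) (fun _ => 0) with hz'
  set y' : {v // v ∈ I \ J} ⊕ {v // v ∈ J \ I} → ℝ := Sum.elim (fun v => y v) (fun _ => 0) with hy'
  have hy'0 : ∀ x, 0 ≤ y' x := by rintro (x | x) <;> simp [hy', hy]
  obtain ⟨m, hm, b, a, hw, hpos, hmin⟩ := exists_shortest_positive hN₁ hN₂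
    (z := z') (y := fun x => (1 + 1 / (q : ℝ)) * y' x) (by
      rw [← Finset.mul_sum, Fintype.sum_sum_type, Fintype.sum_sum_type]
      simp only [hz', hy', Sum.elim_inl, Sum.elim_inr, Finset.sum_const_zero, add_zero]
      rw [Finset.sum_coe_sort (J \ I) z, Finset.sum_coe_sort (I \ J) y]
      exact hcon)
  have hbinj := hw.injective_left hmin hpos
  have hainj := hw.injective_right hmin hpos
  have hdisj : Disjoint (J \ I) (I \ J) := disjoint_sdiff_sdiff
  -- Entering elements indexed by X need their partners for both matroids removed: a i for `M₂` and
  -- a (i + 1) for `M₁`. Hence Y must contain X and its shift.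
  have key : ∀ X Y : Finset (ZMod m), X ⊆ Y → X.image (· + 1) ⊆ Y → X.card ≤ q → Y.card ≤ q + 1 →
      ∑ i ∈ X, z' (b i) ≤ ∑ i ∈ Y, y' (a i) := by
    intro X Y hXY hXY' hXc hYc
    have h₁ := indep_of_unique_matching hK₁ hdisj (a := fun i => a (i + 1)) hbinj hw.next
      (fun τ hτ i => by
        have := hw.perm_eq_succ hmin hpos (τ.trans (Equiv.addRight 1)) (by simpa using hτ) i
        simpa using this) X
    have h₂ := indep_of_unique_matching hK₂ hdisj hbinj hw.same (hw.perm_eq_id hmin hpos) X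
    have := hloc (realPart (Y.image a)) (realPart_subset _) (realPart (X.image b))
      (realPart_subset _)
      ((card_realPart_le _).trans (Finset.card_image_le.trans hYc))
      ((card_realPart_le _).trans (Finset.card_image_le.trans hXc))
      (h₁.subset (by
        intro v hv
        simp only [Finset.coe_union, Finset.coe_sdiff, Set.mem_union, Set.mem_sdiff, Finset.mem_coe,
          mem_realPart, Finset.mem_image] at hv
        rcases hv with ⟨hvI, hn⟩ | ⟨h, i, hi, hbi⟩
        · refine Or.inl ⟨hIK₁ hvI, ?_⟩
          rintro ⟨i, hi, h, hai⟩
          exact hn ⟨h, i + 1, hXY' (Finset.mem_image_of_mem _ hi), hai⟩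
        · exact Or.inr ⟨i, hi, h, hbi⟩))
      (h₂.subset (by
        intro v hv
        simp only [Finset.coe_union, Finset.coe_sdiff, Set.mem_union, Set.mem_sdiff, Finset.mem_coe,
          mem_realPart, Finset.mem_image] at hv
        rcases hv with ⟨hvI, hn⟩ | ⟨h, i, hi, hbi⟩
        · refine Or.inl ⟨hIK₂ hvI, ?_⟩
          rintro ⟨i, hi, h, hai⟩
          exact hn ⟨h, i, hXY hi, hai⟩
        · exact Or.inr ⟨i, hi, h, hbi⟩))
    rw [sum_realPart, sum_realPart, Finset.sum_image hbinj.injOn, Finset.sum_image hainj.injOn]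
      at this
    exact this
  have hY0 : 0 ≤ ∑ i, y' (a i) := Finset.sum_nonneg fun i _ => hy'0 _
  rw [Finset.sum_sub_distrib, ← Finset.mul_sum] at hpos
  -- A walk of length at most q is a single admissible exchange; a longer one is averaged over its
  -- cyclic windows.
  rcases le_or_gt m q with hmq | hmq
  · have := key Finset.univ Finset.univ (Finset.subset_univ _) (Finset.subset_univ _)
      (by simpa using hmq) (by simp; omega)
    have h2 : 0 ≤ 1 / (q : ℝ) * ∑ i, y' (a i) := by positivity
    linarith
  · have hcast : ∀ (i : ZMod m) (L : ℕ), L ≤ m →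
        Set.InjOn (fun k : ℕ => i + (k : ZMod m)) (Finset.range L) := by
      intro i L hL k hk l hl hkl
      simp only [Finset.coe_range, Set.mem_Iio] at hk hl
      have h1 : (k : ZMod m) = l := add_left_cancel hkl
      rw [ZMod.natCast_eq_natCast_iff'] at h1
      rwa [Nat.mod_eq_of_lt (by omega), Nat.mod_eq_of_lt (by omega)] at h1
    -- Over all windows each entering element is counted q times and each leaving one q + 1 times,
    -- which produces the factor 1 + 1/q.
    have hwin : ∀ i : ZMod m, ∑ k ∈ Finset.range q, z' (b (i + (k : ZMod m))) ≤
        ∑ k ∈ Finset.range (q + 1), y' (a (i + (k : ZMod m))) := by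
      intro i
      have := key ((Finset.range q).image fun k : ℕ => i + (k : ZMod m))
        ((Finset.range (q + 1)).image fun k : ℕ => i + (k : ZMod m))
        (Finset.image_subset_image (Finset.range_mono (by omega))) (by
          intro x hx
          simp only [Finset.mem_image, Finset.mem_range] at hx ⊢
          obtain ⟨_, ⟨k, hk, rfl⟩, rfl⟩ := hx
          exact ⟨k + 1, by omega, by push_cast; ring⟩)
        (Finset.card_image_le.trans (by simp)) (Finset.card_image_le.trans (by simp))
      rwa [Finset.sum_image (hcast i q hmq.le), Finset.sum_image (hcast i (q + 1) hmq)] at this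
    have hsum := Finset.sum_le_sum fun i (_ : i ∈ Finset.univ) => hwin i
    rw [Finset.sum_comm, Finset.sum_comm (s := Finset.univ) (t := Finset.range (q + 1))] at hsum
    have e1 : ∀ k : ℕ, ∑ i, z' (b (i + (k : ZMod m))) = ∑ i, z' (b i) := fun k =>
      Equiv.sum_comp (Equiv.addRight (k : ZMod m)) fun i => z' (b i)
    have e2 : ∀ k : ℕ, ∑ i, y' (a (i + (k : ZMod m))) = ∑ i, y' (a i) := fun k =>
      Equiv.sum_comp (Equiv.addRight (k : ZMod m)) fun i => y' (a i)
    simp only [e1, e2, Finset.sum_const, Finset.card_range, nsmul_eq_mul] at hsum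
    push_cast at hsum
    have h3 : (q : ℝ) * ((1 + 1 / (q : ℝ)) * ∑ i, y' (a i)) < q * ∑ i, z' (b i) :=
      mul_lt_mul_of_pos_left (by linarith) hq0
    have h4 : (q : ℝ) * ((1 + 1 / (q : ℝ)) * ∑ i, y' (a i)) = (q + 1) * ∑ i, y' (a i) := by
      field_simp
    linarith

end Exchange

end MatroidCover
namespace MatroidCover

/-! ### Linearizing the potential and comparing covered weights. -/

section Cover

variable {n : ℕ}

/-- The sum that `edgeSum` computes over the real numbers. -/
noncomputable def edgeValue (a : ℕ → ℚ) (w : Sym2 (Fin n) → ℝ) (L : List (Fin n × Fin n))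
    (X : Finset (Fin n)) : ℝ :=
  (L.map fun e => (a (endpointsIn e X) : ℝ) * w s(e.1, e.2)).sum

/-- The sum over the edges at `v`, where an edge from `v` to `u` counts `c u` times. -/
noncomputable def vertexWeight (c : Fin n → ℝ) (w : Sym2 (Fin n) → ℝ) (L : List (Fin n × Fin n))
    (v : Fin n) : ℝ :=
  (L.map fun e =>
    ((if e.1 = v then c e.2 else 0) + (if e.2 = v then c e.1 else 0)) * w s(e.1, e.2)).sum

theorem sum_vertexWeight (c : Fin n → ℝ) (w : Sym2 (Fin n) → ℝ) (L : List (Fin n × Fin n))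
    (A : Finset (Fin n)) :
    ∑ v ∈ A, vertexWeight c w L v = (L.map fun e =>
      ((if e.1 ∈ A then c e.2 else 0) + (if e.2 ∈ A then c e.1 else 0)) * w s(e.1, e.2)).sum := by
  induction L with
  | nil => simp [vertexWeight]
  | cons e L ih =>
    simp only [vertexWeight, List.map_cons, List.sum_cons] at ih ⊢
    rw [Finset.sum_add_distrib, ih, ← Finset.sum_mul, Finset.sum_add_distrib]
    simp [Finset.sum_ite_eq]

/-- The weight, in the linearized loss of removing a vertex of `I \ J`, of an edge to `u`. -/
noncomputable def lossCoeff (I J : Finset (Fin n)) (u : Fin n) : ℝ :=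
  if u ∈ I then (if u ∈ J then 1 / 2 else 3 / 4) else 1

/-- The weight, in the linearized gain of adding a vertex of `J \ I`, of an edge to `u`. -/
noncomputable def gainCoeff (I J : Finset (Fin n)) (u : Fin n) : ℝ :=
  if u ∈ I then 1 / 2 else (if u ∈ J then 3 / 4 else 1)

theorem vertexWeight_nonneg {c : Fin n → ℝ} (hc : ∀ u, 0 ≤ c u) {w : Sym2 (Fin n) → ℝ}
    {L : List (Fin n × Fin n)} (hw : ∀ e ∈ L, 0 ≤ w s(e.1, e.2)) (v : Fin n) :
    0 ≤ vertexWeight c w L v := by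
  refine List.sum_nonneg ?_
  simp only [List.mem_map]
  rintro _ ⟨e, he, rfl⟩
  have := hc e.1
  have := hc e.2
  exact mul_nonneg (by split_ifs <;> positivity) (hw e he)

theorem lossCoeff_nonneg (I J : Finset (Fin n)) (u : Fin n) : 0 ≤ lossCoeff I J u := by
  unfold lossCoeff; split_ifs <;> norm_num

/-- The coefficients are marginal values of 0, 1, 3/2. A neighbour that stays gives 3/2 - 1 = 1/2,
and an uncovered neighbour outside both sets gives 1. If both endpoints may move in the same
direction, each receives 3/4, which is exact when both move and pessimistic when only one does. -/
theorem edge_exchange_bound (e : Fin n × Fin n) {I J A B : Finset (Fin n)} (hA : A ⊆ I \ J)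
    (hB : B ⊆ J \ I) :
    ((if e.1 ∈ B then gainCoeff I J e.2 else 0) + (if e.2 ∈ B then gainCoeff I J e.1 else 0)) +
        potentialCoeff (endpointsIn e I) ≤
      ((if e.1 ∈ A then lossCoeff I J e.2 else 0) + (if e.2 ∈ A then lossCoeff I J e.1 else 0)) +
        potentialCoeff (endpointsIn e (I \ A ∪ B)) := by
  have cases_of : ∀ u : Fin n,
      (u ∈ I ∧ u ∉ J ∧ u ∈ A ∧ u ∉ B) ∨ (u ∈ I ∧ u ∉ J ∧ u ∉ A ∧ u ∉ B) ∨
      (u ∉ I ∧ u ∈ J ∧ u ∉ A ∧ u ∈ B) ∨ (u ∉ I ∧ u ∈ J ∧ u ∉ A ∧ u ∉ B) ∨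
      (u ∈ I ∧ u ∈ J ∧ u ∉ A ∧ u ∉ B) ∨ (u ∉ I ∧ u ∉ J ∧ u ∉ A ∧ u ∉ B) := by
    intro u
    have h1 := @hA u
    have h2 := @hB u
    simp only [Finset.mem_sdiff] at h1 h2
    tauto
  rcases cases_of e.1 with h | h | h | h | h | h <;> rcases cases_of e.2 with h' | h' | h' | h' | h' | h' <;>
    obtain ⟨h1, h2, h3, h4⟩ := h <;> obtain ⟨h5, h6, h7, h8⟩ := h' <;>
    simp only [endpointsIn, gainCoeff, lossCoeff, Finset.mem_union, Finset.mem_sdiff, h1, h2, h3, h4,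
      h5, h6, h7, h8, if_true, if_false, not_true, not_false_iff, and_true, and_false, or_true,
      or_false, and_self, or_self, potentialCoeff] <;> norm_num

/-- The factor 3/2 originates here. It is attained at δ = 0, for instance, by edges inside I \ J and
by edges between I \ J and J \ I. General δ costs nothing, since the loss on an edge is at most 3/2
times its coverage by I. -/
theorem edge_cover_bound (e : Fin n × Fin n) (I J : Finset (Fin n)) {δ : ℝ} (hδ : 0 ≤ δ) :
    (coverCoeff (endpointsIn e J) : ℝ) + (1 + δ) * ((if e.1 ∈ I \ J then lossCoeff I J e.2 else 0) +
        (if e.2 ∈ I \ J then lossCoeff I J e.1 else 0)) ≤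
      ((if e.1 ∈ J \ I then gainCoeff I J e.2 else 0) +
        (if e.2 ∈ J \ I then gainCoeff I J e.1 else 0)) +
      3 / 2 * (1 + δ) * coverCoeff (endpointsIn e I) := by
  by_cases h1 : e.1 ∈ I <;> by_cases h2 : e.1 ∈ J <;> by_cases h3 : e.2 ∈ I <;>
    by_cases h4 : e.2 ∈ J <;>
    simp only [endpointsIn, gainCoeff, lossCoeff, Finset.mem_sdiff, h1, h2, h3, h4, if_true, if_false,
      not_true, not_false_iff, and_true, and_false, and_self, coverCoeff] <;> push_cast <;> linarith

theorem potential_le_cover (k : ℕ) : (potentialCoeff k : ℝ) ≤ 3 / 2 * coverCoeff k := by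
  rcases k with _ | _ | k <;> norm_num [potentialCoeff, coverCoeff]

theorem potentialCoeff_nonneg (k : ℕ) : (0 : ℝ) ≤ potentialCoeff k := by
  rcases k with _ | _ | k <;> norm_num [potentialCoeff]

theorem coverCoeff_nonneg (k : ℕ) : (0 : ℝ) ≤ coverCoeff k := by
  rcases k with _ | k <;> norm_num [coverCoeff]

variable {w : Sym2 (Fin n) → ℝ} {L : List (Fin n × Fin n)}

theorem edgeValue_nonneg {a : ℕ → ℚ} (ha : ∀ k, (0 : ℝ) ≤ a k)
    (hw : ∀ e ∈ L, 0 ≤ w s(e.1, e.2)) (X : Finset (Fin n)) : 0 ≤ edgeValue a w L X := by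
  refine List.sum_nonneg ?_
  simp only [List.mem_map]
  rintro _ ⟨e, he, rfl⟩
  exact mul_nonneg (ha _) (hw e he)

theorem potentialValue_le (hw : ∀ e ∈ L, 0 ≤ w s(e.1, e.2)) (X : Finset (Fin n)) :
    edgeValue potentialCoeff w L X ≤ 3 / 2 * edgeValue coverCoeff w L X := by
  simp only [edgeValue]
  rw [← List.sum_map_mul_left]
  refine List.sum_le_sum fun e he => ?_
  have := mul_le_mul_of_nonneg_right (potential_le_cover (endpointsIn e X)) (hw e he)
  linarith

theorem exchange_potential_bound (hw : ∀ e ∈ L, 0 ≤ w s(e.1, e.2)) {I J A B : Finset (Fin n)}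
    (hA : A ⊆ I \ J) (hB : B ⊆ J \ I) :
    ∑ v ∈ B, vertexWeight (gainCoeff I J) w L v + edgeValue potentialCoeff w L I ≤
      ∑ v ∈ A, vertexWeight (lossCoeff I J) w L v + edgeValue potentialCoeff w L (I \ A ∪ B) := by
  rw [sum_vertexWeight, sum_vertexWeight]
  simp only [edgeValue]
  rw [← List.sum_map_add, ← List.sum_map_add]
  refine List.sum_le_sum fun e he => ?_
  have := mul_le_mul_of_nonneg_right (edge_exchange_bound e hA hB) (hw e he)
  linarith

theorem cover_value_bound (hw : ∀ e ∈ L, 0 ≤ w s(e.1, e.2)) (I J : Finset (Fin n)) {δ : ℝ}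
    (hδ : 0 ≤ δ) :
    edgeValue coverCoeff w L J + (1 + δ) * ∑ v ∈ I \ J, vertexWeight (lossCoeff I J) w L v ≤
      ∑ v ∈ J \ I, vertexWeight (gainCoeff I J) w L v +
        3 / 2 * (1 + δ) * edgeValue coverCoeff w L I := by
  rw [sum_vertexWeight, sum_vertexWeight]
  simp only [edgeValue]
  rw [← List.sum_map_mul_left, ← List.sum_map_mul_left, ← List.sum_map_add, ← List.sum_map_add]
  refine List.sum_le_sum fun e he => ?_
  have := mul_le_mul_of_nonneg_right (edge_cover_bound e I J hδ) (hw e he)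
  linarith

/-- A local optimum of the potential, contracted at `v`, covers about two thirds of the best value. -/
theorem cover_le_of_local_optimum (hw : ∀ e ∈ L, 0 ≤ w s(e.1, e.2)) {M₁ M₂ : Matroid (Fin n)}
    {v : Fin n} {I J : Finset (Fin n)} (hvI : v ∉ I) (hvJ : v ∉ J)
    (hI₁ : M₁.Indep (insert v I : Finset (Fin n))) (hI₂ : M₂.Indep (insert v I : Finset (Fin n)))
    (hJ₁ : M₁.Indep (insert v J : Finset (Fin n))) (hJ₂ : M₂.Indep (insert v J : Finset (Fin n)))
    {p : ℕ} (hp : 1 ≤ p) {ε : ℝ} (hε : 0 ≤ ε)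
    (hloc : ∀ A ⊆ I, ∀ B : Finset (Fin n), Disjoint B I → v ∉ B → A.card ≤ 2 * p + 1 →
      B.card ≤ 2 * p → M₁.Indep (insert v (I \ A ∪ B) : Finset (Fin n)) →
      M₂.Indep (insert v (I \ A ∪ B) : Finset (Fin n)) →
      edgeValue potentialCoeff w L (I \ A ∪ B) ≤ (1 + ε) * edgeValue potentialCoeff w L I) :
    edgeValue coverCoeff w L J ≤ 3 / 2 * (1 + 1 / (p : ℝ)) * edgeValue coverCoeff w L I +
      n * (ε * (3 / 2 * edgeValue coverCoeff w L I)) := by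
  set η := ε * edgeValue potentialCoeff w L I with hη
  have hη0 : 0 ≤ η := mul_nonneg hε (edgeValue_nonneg potentialCoeff_nonneg hw I)
  have d1 : insert v I \ insert v J = I \ J := by
    ext x; simp only [Finset.mem_sdiff, Finset.mem_insert]
    refine ⟨by tauto, fun h => ⟨Or.inr h.1, ?_⟩⟩
    rintro (rfl | h')
    · exact hvI h.1
    · exact h.2 h'
  have d2 : insert v J \ insert v I = J \ I := by
    ext x; simp only [Finset.mem_sdiff, Finset.mem_insert]
    refine ⟨by tauto, fun h => ⟨Or.inr h.1, ?_⟩⟩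
    rintro (rfl | h')
    · exact hvJ h.1
    · exact h.2 h'
  -- Charging η to every entering vertex turns approximate optimality into the exact hypothesis of
  -- the exchange theorem, except that B = ∅ needs nonnegative losses instead. Using q = p suffices,
  -- within the permitted sizes. The vertex v lies in both sets and never moves, so no contracted
  -- matroid is needed.
  have main := sum_le_of_exchange_le hI₁ hI₂ hJ₁ hJ₂ hp
    (z := fun u => vertexWeight (gainCoeff I J) w L u - η)
    (y := vertexWeight (lossCoeff I J) w L)
    (vertexWeight_nonneg (lossCoeff_nonneg I J) hw) (by
      rw [d1, d2]
      intro A hA B hB hAc hBc h₁ h₂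
      rcases B.eq_empty_or_nonempty with rfl | hne
      · rw [Finset.sum_empty]
        exact Finset.sum_nonneg fun u _ => vertexWeight_nonneg (lossCoeff_nonneg I J) hw u
      have hvA : v ∉ A := fun h => hvI (Finset.mem_sdiff.1 (hA h)).1
      have hset : insert v I \ A ∪ B = insert v (I \ A ∪ B) := by
        rw [Finset.insert_sdiff_of_notMem _ hvA, Finset.insert_union]
      rw [hset] at h₁ h₂
      have h3 := hloc A (hA.trans Finset.sdiff_subset) B
        (Finset.disjoint_left.2 fun x hx => (Finset.mem_sdiff.1 (hB hx)).2)
        (fun h => hvJ (Finset.mem_sdiff.1 (hB h)).1) (by omega) (by omega) h₁ h₂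
      have h4 := exchange_potential_bound hw hA hB
      rw [Finset.sum_sub_distrib, Finset.sum_const, nsmul_eq_mul]
      have h5 : (1 : ℝ) ≤ B.card := by exact_mod_cast hne.card_pos
      have h6 : η ≤ B.card * η := le_mul_of_one_le_left hη0 h5
      linarith)
  rw [d1, d2, Finset.sum_sub_distrib, Finset.sum_const, nsmul_eq_mul] at main
  have h1 := cover_value_bound hw I J (δ := 1 / (p : ℝ)) (by positivity)
  have h2 : ((J \ I).card : ℝ) * η ≤ n * η :=
    mul_le_mul_of_nonneg_right (by exact_mod_cast card_finset_fin_le _) hη0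
  have h3 : (n : ℝ) * η ≤ n * (ε * (3 / 2 * edgeValue coverCoeff w L I)) := by
    exact mul_le_mul_of_nonneg_left (mul_le_mul_of_nonneg_left (potentialValue_le hw I) hε)
      (Nat.cast_nonneg n)
  linarith

end Cover

end MatroidCover
namespace MatroidCover

/-! ### Termination, correctness and cost of programs. -/

section Programs

variable {n : ℕ} {M₁ M₂ : Matroid (Fin n)} {α β σ : Type}

/-- The program terminates with a value that satisfies `Q`, after at most `t` arithmetic operations and at
most `t` oracle calls. -/
def Spec (M₁ M₂ : Matroid (Fin n)) (x : Prog n ℝ α) (t : ℕ) (Q : α → Prop) : Prop :=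
  ∃ r ∈ x.run M₁ M₂, Q r.val ∧ r.ops ≤ t ∧ r.calls ≤ t

theorem Spec.mono {x : Prog n ℝ α} {t t' : ℕ} {Q Q' : α → Prop} (h : Spec M₁ M₂ x t Q)
    (ht : t ≤ t') (hQ : ∀ a, Q a → Q' a) : Spec M₁ M₂ x t' Q' := by
  obtain ⟨r, hr, h1, h2, h3⟩ := h
  exact ⟨r, hr, hQ _ h1, h2.trans ht, h3.trans ht⟩

theorem Spec.pure {a : α} {t : ℕ} {Q : α → Prop} (h : Q a) :
    Spec M₁ M₂ (pure a : Prog n ℝ α) t Q := by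
  refine ⟨⟨a, 0, 0⟩, ?_, h, Nat.zero_le _, Nat.zero_le _⟩
  change _ ∈ Prog.run M₁ M₂ (Prog.ret a)
  simp [Prog.run]

theorem Spec.bind {x : Prog n ℝ α} {f : α → Prog n ℝ β} {t s : ℕ} {Q : α → Prop} {P : β → Prop}
    (hx : Spec M₁ M₂ x t Q) (hf : ∀ a, Q a → Spec M₁ M₂ (f a) s P) :
    Spec M₁ M₂ (x >>= f) (t + s) P := by
  obtain ⟨r, hr, h1, h2, h3⟩ := hx
  obtain ⟨r', hr', h1', h2', h3'⟩ := hf _ h1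
  refine ⟨⟨r'.val, r.ops + r'.ops, r.calls + r'.calls⟩, ?_, h1', by simp; omega, by simp; omega⟩
  change _ ∈ Prog.run M₁ M₂ (Prog.bind x f)
  simp only [Prog.run, Part.mem_bind_iff, Part.mem_map_iff]
  exact ⟨r, hr, r', hr', rfl⟩

theorem Spec.const (q : ℚ) : Spec M₁ M₂ (Prog.const q) 1 (· = (q : ℝ)) :=
  ⟨⟨q, 1, 0⟩, by simp [Prog.run], rfl, le_rfl, Nat.zero_le _⟩

theorem Spec.add (x y : ℝ) : Spec M₁ M₂ (Prog.add x y) 1 (· = x + y) :=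
  ⟨⟨x + y, 1, 0⟩, by simp [Prog.run], rfl, le_rfl, Nat.zero_le _⟩

theorem Spec.mul (x y : ℝ) : Spec M₁ M₂ (Prog.mul x y) 1 (· = x * y) :=
  ⟨⟨x * y, 1, 0⟩, by simp [Prog.run], rfl, le_rfl, Nat.zero_le _⟩

theorem Spec.less (x y : ℝ) : Spec M₁ M₂ (Prog.less x y) 1 (fun b => b = true ↔ x < y) := by
  classical
  exact ⟨⟨decide (x < y), 1, 0⟩, by simp [Prog.run], by simp, le_rfl, Nat.zero_le _⟩

theorem Spec.oracle (i : Bool) (X : Finset (Fin n)) : Spec M₁ M₂ (Prog.oracle i X) 1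
    (fun b => b = true ↔ (if i then M₂ else M₁).Indep (X : Set (Fin n))) := by
  classical
  exact ⟨⟨decide ((if i then M₂ else M₁).Indep (X : Set (Fin n))), 0, 1⟩, by simp [Prog.run], by simp,
    Nat.zero_le _, le_rfl⟩

theorem Spec.foldlM {γ : Type} {f : σ → γ → Prog n ℝ σ} {t : ℕ} {P : List γ → σ → Prop}
    (l : List γ) (hf : ∀ l₁ x s, x ∈ l → P l₁ s → Spec M₁ M₂ (f s x) t (P (l₁ ++ [x]))) (l₀ : List γ)
    (s : σ) (h₀ : P l₀ s) : Spec M₁ M₂ (l.foldlM f s) (l.length * t) (P (l₀ ++ l)) := by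
  induction l generalizing l₀ s with
  | nil => simpa using Spec.pure h₀
  | cons x l ih =>
    rw [List.foldlM_cons]
    refine (Spec.bind (hf l₀ x s (by simp) h₀) fun s' hs' =>
      ih (fun l₁ x s hx => hf l₁ x s (List.mem_cons_of_mem _ hx)) _ s' hs').mono ?_ ?_
    · rw [List.length_cons]; ring_nf; exact le_rfl
    · intro a ha; simpa using ha

theorem Spec.findM {γ : Type} {q : γ → Prog n ℝ Bool} {t : ℕ} {φ : γ → Prop} (l : List γ)
    (hq : ∀ x ∈ l, Spec M₁ M₂ (q x) t (fun b => b = true ↔ φ x)) :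
    Spec M₁ M₂ (l.findM? q) (l.length * t)
      (fun r => (r = none → ∀ x ∈ l, ¬ φ x) ∧ ∀ x, r = some x → x ∈ l ∧ φ x) := by
  induction l with
  | nil => exact Spec.pure ⟨fun _ x hx => absurd hx (by simp), fun x hx => by cases hx⟩
  | cons x l ih =>
    rw [List.findM?]
    refine (Spec.bind (s := l.length * t) (hq x (by simp)) fun b hb => ?_).mono
      (by rw [List.length_cons]; ring_nf; exact le_rfl) (fun a ha => ha)
    cases b
    · refine (ih fun y hy => hq y (List.mem_cons_of_mem _ hy)).mono le_rfl fun r hr => ⟨?_, ?_⟩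
      · intro h y hy
        rcases List.mem_cons.1 hy with rfl | hy
        · intro hφ; simpa using hb.2 hφ
        · exact hr.1 h y hy
      · intro y hy
        exact ⟨List.mem_cons_of_mem _ (hr.2 y hy).1, (hr.2 y hy).2⟩
    · refine Spec.pure ⟨fun h => (by cases h), fun y hy => ?_⟩
      obtain rfl : x = y := Option.some.inj hy
      exact ⟨by simp, hb.1 rfl⟩

/-- The invariant is indexed by the number of completed rounds. Since it can hold only for indices
below K, the loop stops, and each round costs at most t. -/
theorem Spec.loop {body : σ → Prog n ℝ (α ⊕ σ)} {t K : ℕ} {Q : α → Prop} {P : ℕ → σ → Prop}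
    (hbody : ∀ k s, P k s → Spec M₁ M₂ (body s) t (Sum.elim Q (P (k + 1))))
    (hK : ∀ k s, P k s → k < K) {s : σ} (h₀ : P 0 s) : Spec M₁ M₂ (Prog.loop s body) (K * t) Q := by
  have claim : ∀ d k s o c, P k s → K - k ≤ d → o ≤ k * t → c ≤ k * t →
      ∃ r ∈ PFun.fix (loopStep fun s' => (body s').run M₁ M₂) ⟨s, o, c⟩,
        Q r.val ∧ r.ops ≤ K * t ∧ r.calls ≤ K * t := by
    intro d
    induction d with
    | zero => intro k s o c hP hd; have := hK k s hP; omega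
    | succ d ih =>
      intro k s o c hP hd ho hc
      have hk := hK k s hP
      have hkt : (k + 1) * t ≤ K * t := Nat.mul_le_mul_right t hk
      rw [Nat.add_mul, one_mul] at hkt
      obtain ⟨⟨v, ro, rc⟩, hr, h1, h2, h3⟩ := hbody k s hP
      simp only at h1 h2 h3
      rcases v with a | s'
      · refine ⟨⟨a, o + ro, c + rc⟩, PFun.fix_stop ?_, h1, by simp; omega, by simp; omega⟩
        simp only [loopStep, Part.mem_map_iff]
        exact ⟨_, hr, rfl⟩
      · have hstep : Sum.inr ⟨s', o + ro, c + rc⟩ ∈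
            loopStep (fun s' => (body s').run M₁ M₂) (⟨s, o, c⟩ : Counted σ) := by
          simp only [loopStep, Part.mem_map_iff]
          exact ⟨_, hr, rfl⟩
        rw [PFun.fix_fwd_eq hstep]
        exact ih (k + 1) s' _ _ h1 (by omega) (by rw [Nat.add_mul]; omega)
          (by rw [Nat.add_mul]; omega)
  obtain ⟨r, hr, h⟩ := claim K 0 s 0 0 h₀ (by omega) (by simp) (by simp)
  exact ⟨r, by simpa only [Prog.run] using hr, h⟩

theorem spec_edgeSum (a : ℕ → ℚ) (w : Sym2 (Fin n) → ℝ) (L : List (Fin n × Fin n))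
    (X : Finset (Fin n)) :
    Spec M₁ M₂ (edgeSum a w L X) (1 + L.length * 3) (· = edgeValue a w L X) := by
  refine Spec.bind (Spec.const 0) fun z hz => ?_
  refine (Spec.foldlM (P := fun l s => s = edgeValue a w l X) L ?_ [] z ?_).mono le_rfl
    fun r hr => by simpa using hr
  · intro l₁ e s _ hs
    refine Spec.bind (Spec.const _) (s := 2) fun c hc => Spec.bind (Spec.mul _ _) (s := 1) fun u hu =>
      (Spec.add _ _).mono le_rfl fun r hr => ?_
    rw [hr, hu, hc, hs]
    simp [edgeValue]
  · simp [hz, edgeValue]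

theorem spec_commonIndep (X : Finset (Fin n)) : Spec M₁ M₂ (commonIndep X) 2
    (fun b => b = true ↔ M₁.Indep (X : Set (Fin n)) ∧ M₂.Indep (X : Set (Fin n))) := by
  refine Spec.bind (Spec.oracle false X) (s := 1) fun b₁ h₁ =>
    Spec.bind (Spec.oracle true X) (s := 0) fun b₂ h₂ => Spec.pure ?_
  rw [Bool.and_eq_true, h₁, h₂]
  simp

/-! ### Greedy and local search for an abstract monotone function. -/

section Search

variable {feasible : Finset (Fin n) → Prog n ℝ Bool} {g : Finset (Fin n) → Prog n ℝ ℝ}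
  {F : Finset (Fin n) → Prop} {gv : Finset (Fin n) → ℝ} {tf tg : ℕ}

/-- The first round picks a best feasible singleton and later rounds can only increase g; stopping
at ∅ means that no singleton is feasible. The cardinality grows by one per round, which bounds the
rounds. -/
theorem spec_greedy (hF : ∀ X, Spec M₁ M₂ (feasible X) tf (fun b => b = true ↔ F X))
    (hg : ∀ X, Spec M₁ M₂ (g X) tg (· = gv X)) (hmono : ∀ X Y, X ⊆ Y → gv X ≤ gv Y) (hF0 : F ∅)
    (verts : List (Fin n)) : Spec M₁ M₂ (greedy feasible g verts)
      ((n + 1) * (verts.length * (tf + (tg + 1))))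
      (fun S => F S ∧ (∀ x ∈ S, x ∈ verts) ∧ ∀ x ∈ verts, F {x} → gv {x} ≤ gv S) := by
  refine Spec.loop (P := fun k S => S.card = k ∧ F S ∧ (∀ x ∈ S, x ∈ verts) ∧
    (S = ∅ ∨ ∀ x ∈ verts, F {x} → gv {x} ≤ gv S)) ?_ ?_ ?_
  · rintro k S ⟨hk, hFS, hSv, hS⟩
    refine (Spec.bind (s := 0) (Spec.foldlM (t := tf + (tg + 1)) (P := fun l best =>
      (best = none → ∀ u ∈ l, ¬ F (insert u S)) ∧ ∀ v x, best = some (v, x) →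
        v ∉ S ∧ v ∈ verts ∧ F (insert v S) ∧ x = gv (insert v S) ∧
          ∀ u ∈ l, F (insert u S) → gv (insert u S) ≤ x)
      (verts.filter (· ∉ S)) ?_ [] none ⟨fun _ u hu => absurd hu (by simp), fun v x h => by cases h⟩)
      ?_).mono (Nat.mul_le_mul_right _ (List.length_filter_le _ _)) fun r hr => hr
    · rintro l₁ v best hv ⟨hb₁, hb₂⟩
      obtain ⟨hvv, hvS⟩ : v ∈ verts ∧ v ∉ S := by simpa using hv
      refine Spec.bind (hF _) fun c hc => ?_
      split_ifs with h
      · have hFv := hc.1 h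
        refine Spec.bind (hg _) fun x hx => ?_
        rcases best with _ | ⟨v', y⟩
        · refine Spec.pure ⟨fun h => by (cases h), fun u x' hu => ?_⟩
          obtain ⟨rfl, rfl⟩ := Prod.mk.inj (Option.some.inj hu)
          refine ⟨hvS, hvv, hFv, hx, fun u hu hFu => ?_⟩
          rcases List.mem_append.1 hu with hu | hu
          · exact absurd hFu (hb₁ rfl u hu)
          · rw [List.mem_singleton.1 hu, hx]
        · obtain ⟨h1, h2, h3, h5, h4⟩ := hb₂ v' y rfl
          refine Spec.bind (Spec.less y x) (s := 0) fun c' hc' => ?_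
          split_ifs with h'
          · refine Spec.pure ⟨fun h => by (cases h), fun u x' hu => ?_⟩
            obtain ⟨rfl, rfl⟩ := Prod.mk.inj (Option.some.inj hu)
            refine ⟨hvS, hvv, hFv, hx, fun u hu hFu => ?_⟩
            rcases List.mem_append.1 hu with hu | hu
            · exact (h4 u hu hFu).trans (hc'.1 h').le
            · rw [List.mem_singleton.1 hu, hx]
          · refine Spec.pure ⟨fun h => by (cases h), fun u x' hu => ?_⟩
            obtain ⟨rfl, rfl⟩ := Prod.mk.inj (Option.some.inj hu)
            refine ⟨h1, h2, h3, h5, fun u hu hFu => ?_⟩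
            rcases List.mem_append.1 hu with hu | hu
            · exact h4 u hu hFu
            · rw [List.mem_singleton.1 hu, ← hx]
              exact not_lt.1 fun hlt => h' (hc'.2 hlt)
      · refine Spec.pure ⟨fun hn u hu => ?_, fun u x hu => ?_⟩
        · rcases List.mem_append.1 hu with hu | hu
          · exact hb₁ hn u hu
          · rw [List.mem_singleton.1 hu]; exact fun hFv => h (hc.2 hFv)
        · obtain ⟨h1, h2, h3, h5, h4⟩ := hb₂ u x hu
          refine ⟨h1, h2, h3, h5, fun u hu hFu => ?_⟩
          rcases List.mem_append.1 hu with hu | hu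
          · exact h4 u hu hFu
          · rw [List.mem_singleton.1 hu] at hFu
            exact absurd (hc.2 hFu) h
    · rintro best ⟨hb₁, hb₂⟩
      rcases best with _ | ⟨v, x⟩
      · refine Spec.pure ⟨hFS, hSv, ?_⟩
        rcases hS with rfl | hS
        · intro u hu hFu
          refine absurd ?_ (hb₁ rfl u (by simpa using hu))
          simpa using hFu
        · exact hS
      · obtain ⟨h1, h2, h3, h5, h4⟩ := hb₂ v x rfl
        refine Spec.pure ⟨by rw [Finset.card_insert_of_notMem h1, hk], h3, ?_, Or.inr ?_⟩
        · intro u hu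
          rcases Finset.mem_insert.1 hu with rfl | hu
          · exact h2
          · exact hSv u hu
        · intro u hu hFu
          rcases hS with rfl | hS
          · rw [← h5]
            simpa using h4 u (by simpa using hu) (by simpa using hFu)
          · exact (hS u hu hFu).trans (hmono _ _ (Finset.subset_insert _ _))
  · rintro k S ⟨rfl, -⟩
    exact Nat.lt_succ_of_le (card_finset_fin_le S)
  · exact ⟨rfl, hF0, by simp, Or.inl rfl⟩

/-- Subadditivity and downward closure bound every feasible value by n times the greedy value. After
k improvements (1 + ε)^k ≤ n whenever that value is positive, and Bernoulli's inequality gives kε ≤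
n ≤ Kε. -/
theorem spec_localSearch (hF : ∀ X, Spec M₁ M₂ (feasible X) tf (fun b => b = true ↔ F X))
    (hg : ∀ X, Spec M₁ M₂ (g X) tg (· = gv X)) (hmono : ∀ X Y, X ⊆ Y → gv X ≤ gv Y)
    (hpos : ∀ X, 0 ≤ gv X) (hsub : ∀ X, gv X ≤ ∑ x ∈ X, gv {x}) (hF0 : F ∅)
    (hdown : ∀ X Y, X ⊆ Y → F Y → F X) {p : ℕ} {verts : List (Fin n)} {D K : ℕ} {ε : ℚ} (hε : 0 < ε)
    (hD : ∀ S, (exchanges p verts S).length ≤ D)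
    (hexch : ∀ S, (∀ x ∈ S, x ∈ verts) → ∀ X ∈ exchanges p verts S, ∀ x ∈ X, x ∈ verts)
    (hK : (n : ℝ) ≤ K * ε) : Spec M₁ M₂ (localSearch p ε feasible g verts)
      ((n + 1) * (verts.length * (tf + (tg + 1))) +
        (K + 1) * (1 + (tg + (1 + D * (tf + (tg + 1))))))
      (fun S => F S ∧ (∀ x ∈ S, x ∈ verts) ∧
        ∀ X ∈ exchanges p verts S, F X → gv X ≤ (1 + ε) * gv S) := by
  have hε' : (0 : ℝ) < ε := by exact_mod_cast hε
  refine Spec.bind (spec_greedy hF hg hmono hF0 verts) fun S₀ hS₀ => ?_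
  obtain ⟨hFS₀, hS₀v, hS₀g⟩ := hS₀
  have hmax : ∀ X, F X → (∀ x ∈ X, x ∈ verts) → gv X ≤ n * gv S₀ := by
    intro X hFX hXv
    calc gv X ≤ ∑ x ∈ X, gv {x} := hsub X
      _ ≤ ∑ _x ∈ X, gv S₀ := Finset.sum_le_sum fun x hx =>
          hS₀g x (hXv x hx) (hdown _ _ (Finset.singleton_subset_iff.2 hx) hFX)
      _ = X.card * gv S₀ := by rw [Finset.sum_const, nsmul_eq_mul]
      _ ≤ n * gv S₀ := mul_le_mul_of_nonneg_right
          (by exact_mod_cast card_finset_fin_le X) (hpos _)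
  -- The last clause allows cancelling `gv S₀`: if it is zero, all feasible values vanish and no
  -- strict improvement can occur.
  refine Spec.loop (P := fun k S => F S ∧ (∀ x ∈ S, x ∈ verts) ∧ (1 + (ε : ℝ)) ^ k * gv S₀ ≤ gv S ∧
    (k = 0 ∨ 0 < gv S₀)) ?_ ?_ ?_
  · rintro k S ⟨hFS, hSv, hS, hk⟩
    refine Spec.bind (Spec.const _) fun c hc => Spec.bind (hg S) fun y hy =>
      Spec.bind (Spec.mul c y) fun θ hθ => ?_
    have hθ' : θ = (1 + (ε : ℝ)) * gv S := by rw [hθ, hc, hy]; push_cast; rfl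
    refine (Spec.bind (s := 0) (Spec.findM (t := tf + (tg + 1))
      (φ := fun X => F X ∧ (1 + (ε : ℝ)) * gv S < gv X) (exchanges p verts S) ?_) ?_).mono
      (Nat.mul_le_mul_right _ (hD S)) fun r hr => hr
    · intro X _
      refine Spec.bind (hF X) fun b hb => ?_
      split_ifs with h
      · refine Spec.bind (hg X) fun x hx => (Spec.less θ x).mono le_rfl fun b' hb' => ?_
        rw [hb', hθ', hx]
        exact ⟨fun h' => ⟨hb.1 h, h'⟩, fun h' => h'.2⟩
      · refine Spec.pure ⟨fun h' => by (cases h'), fun h' => absurd (hb.2 h'.1) h⟩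
    · rintro found ⟨h₁, h₂⟩
      rcases found with _ | X
      · exact Spec.pure ⟨hFS, hSv, fun X hX hFX => not_lt.1 fun hlt => h₁ rfl X hX ⟨hFX, hlt⟩⟩
      · obtain ⟨hX, hFX, hlt⟩ := h₂ X rfl
        have hXv := hexch S hSv X hX
        refine Spec.pure ⟨hFX, hXv, ?_, Or.inr ?_⟩
        · rw [pow_succ', mul_assoc]
          exact (mul_le_mul_of_nonneg_left hS (by linarith)).trans hlt.le
        · have h3 := hmax X hFX hXv
          have h4 : 0 ≤ (1 + (ε : ℝ)) * gv S := mul_nonneg (by linarith) (hpos S)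
          by_contra hcon
          have h5 : gv S₀ = 0 := le_antisymm (not_lt.1 hcon) (hpos _)
          rw [h5, mul_zero] at h3
          linarith
  · rintro k S ⟨hFS, hSv, hS, hk⟩
    rcases hk with rfl | hk
    · omega
    have h1 := hS.trans (hmax S hFS hSv)
    have h2 : (1 + (ε : ℝ)) ^ k ≤ n := le_of_mul_le_mul_right h1 hk
    have h3 := one_add_mul_le_pow (show (-2 : ℝ) ≤ ε by linarith) k
    have h4 : (k : ℝ) * ε ≤ K * ε := by linarith
    have h5 : (k : ℝ) ≤ K := le_of_mul_le_mul_right h4 hε'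
    exact Nat.lt_succ_of_le (by exact_mod_cast h5)
  · exact ⟨hFS₀, hS₀v, by simp, Or.inl rfl⟩

end Search

end Programs

end MatroidCover
namespace MatroidCover

/-! ### Counting the enumerated exchanges and completeness of the enumeration. -/

section Exchanges

variable {n : ℕ}

theorem length_smallSublists_le {N : ℕ} (hN : 2 ≤ N) (d : ℕ) {l : List (Fin n)} (hl : l.length ≤ N) :
    (smallSublists d l).length ≤ N ^ (d + 1) := by
  have hch : ∀ j, (l.sublistsLen j).length ≤ N ^ j := fun j => by
    rw [List.length_sublistsLen]
    exact (Nat.choose_le_pow _ _).trans (Nat.pow_le_pow_left hl j)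
  induction d with
  | zero =>
    have := hch 0
    simp [smallSublists] at this ⊢
    omega
  | succ d ih =>
    have hs : smallSublists (d + 1) l = smallSublists d l ++ l.sublistsLen (d + 1) := by
      unfold smallSublists
      rw [List.range_succ (n := d + 1), List.flatMap_append]
      simp
    rw [hs, List.length_append, pow_succ N (d + 1)]
    have := hch (d + 1)
    have := Nat.mul_le_mul_left (N ^ (d + 1)) hN
    omega

theorem length_exchanges_le {N : ℕ} (hN : 2 ≤ N) (p : ℕ) {verts : List (Fin n)}
    (hl : verts.length ≤ N) (S : Finset (Fin n)) :
    (exchanges p verts S).length ≤ N ^ (4 * p + 3) := by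
  unfold exchanges
  simp only [List.length_flatMap, List.length_map, List.map_const', List.sum_replicate, smul_eq_mul]
  calc _ ≤ N ^ (2 * p + 1 + 1) * N ^ (2 * p + 1) := Nat.mul_le_mul
        (length_smallSublists_le hN _ ((List.length_filter_le _ _).trans hl))
        (length_smallSublists_le hN _ ((List.length_filter_le _ _).trans hl))
    _ = N ^ (4 * p + 3) := by rw [← pow_add]; congr 1; ring

theorem mem_smallSublists {d : ℕ} {l l' : List (Fin n)} :
    l' ∈ smallSublists d l ↔ l'.Sublist l ∧ l'.length ≤ d := by
  simp only [smallSublists, List.mem_flatMap, List.mem_range, List.mem_sublistsLen]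
  constructor
  · rintro ⟨j, hj, h, rfl⟩; exact ⟨h, by omega⟩
  · rintro ⟨h, hd⟩; exact ⟨_, by omega, h, rfl⟩

theorem exists_smallSublist {d : ℕ} {l : List (Fin n)} (hl : l.Nodup) {A : Finset (Fin n)}
    (hA : ∀ x ∈ A, x ∈ l) (hd : A.card ≤ d) : ∃ l' ∈ smallSublists d l, l'.toFinset = A := by
  refine ⟨l.filter (· ∈ A), mem_smallSublists.2 ⟨List.filter_sublist, ?_⟩, ?_⟩
  · rw [← List.toFinset_card_of_nodup (hl.filter _)]
    refine (Finset.card_le_card fun x hx => ?_).trans hd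
    simpa using (List.mem_filter.1 (List.mem_toFinset.1 hx)).2
  · ext x
    simp only [List.mem_toFinset, List.mem_filter, decide_eq_true_eq]
    exact ⟨fun h => h.2, fun h => ⟨hA x h, h⟩⟩

theorem mem_exchanges {p : ℕ} {verts : List (Fin n)} (hv : verts.Nodup) {S A B : Finset (Fin n)}
    (hS : ∀ x ∈ S, x ∈ verts) (hA : A ⊆ S) (hB : ∀ x ∈ B, x ∈ verts) (hBS : Disjoint B S)
    (hAc : A.card ≤ 2 * p + 1) (hBc : B.card ≤ 2 * p) : S \ A ∪ B ∈ exchanges p verts S := by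
  obtain ⟨lA, hlA, rfl⟩ := exists_smallSublist (hv.filter (· ∈ S)) (A := A)
    (fun x hx => by simpa using ⟨hS x (hA hx), hA hx⟩) hAc
  obtain ⟨lB, hlB, rfl⟩ := exists_smallSublist (hv.filter (· ∉ S)) (A := B)
    (fun x hx => by simpa using ⟨hB x hx, Finset.disjoint_left.1 hBS hx⟩) hBc
  simp only [exchanges, List.mem_flatMap, List.mem_map]
  exact ⟨lA, hlA, lB, hlB, rfl⟩

theorem subset_of_mem_exchanges {p : ℕ} {verts : List (Fin n)} {S : Finset (Fin n)}
    (hS : ∀ x ∈ S, x ∈ verts) {X : Finset (Fin n)} (hX : X ∈ exchanges p verts S) {x : Fin n}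
    (hx : x ∈ X) : x ∈ verts := by
  simp only [exchanges, List.mem_flatMap, List.mem_map] at hX
  obtain ⟨lA, -, lB, hlB, rfl⟩ := hX
  rcases Finset.mem_union.1 hx with hx | hx
  · exact hS x (Finset.mem_sdiff.1 hx).1
  · exact List.mem_of_mem_filter ((mem_smallSublists.1 hlB).1.subset (List.mem_toFinset.1 hx))

end Exchanges

/-! ### Edge sums over the edge list and the effect of deleting a vertex. -/

section Edges

variable {n : ℕ} {w : Sym2 (Fin n) → ℝ}

theorem length_edgeList_le (G : SimpleGraph (Fin n)) [DecidableRel G.Adj] :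
    (edgeList G).length ≤ n ^ 2 := by
  refine (List.length_filter_le _ _).trans ?_
  rw [show ((List.finRange n).product (List.finRange n)).length = _ from List.length_product ..]
  simp [sq]

theorem mem_edgeList {G : SimpleGraph (Fin n)} [DecidableRel G.Adj] {e : Fin n × Fin n} :
    e ∈ edgeList G ↔ e.1 < e.2 ∧ G.Adj e.1 e.2 := by
  simp only [edgeList, List.mem_filter, decide_eq_true_eq, and_iff_right_iff_imp]
  exact fun _ => List.mem_product.2 ⟨List.mem_finRange _, List.mem_finRange _⟩

theorem coveredWeight_eq_edgeValue (G : SimpleGraph (Fin n)) [DecidableRel G.Adj]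
    (w : Sym2 (Fin n) → ℝ) (S : Finset (Fin n)) :
    coveredWeight G w S = edgeValue coverCoeff w (edgeList G) S := by
  have hnd : (edgeList G).Nodup :=
    ((List.nodup_finRange n).product (List.nodup_finRange n)).filter _
  rw [coveredWeight, Finset.sum_filter, edgeValue, ← List.sum_toFinset _ hnd]
  symm
  refine Finset.sum_nbij (fun e => s(e.1, e.2)) ?_ ?_ ?_ ?_
  · intro e he
    simpa using (mem_edgeList.1 (List.mem_toFinset.1 he)).2
  · intro e he f hf hef
    have h1 := (mem_edgeList.1 (List.mem_toFinset.1 he)).1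
    have h2 := (mem_edgeList.1 (List.mem_toFinset.1 hf)).1
    rcases Sym2.eq_iff.1 hef with h | h
    · exact Prod.ext h.1 h.2
    · rw [h.1, h.2] at h1
      exact absurd h1 (lt_asymm h2)
  · intro e
    induction e using Sym2.ind with
    | _ x y =>
      intro h
      have hadj : G.Adj x y := by simpa using h
      rcases lt_trichotomy x y with hlt | rfl | hlt
      · exact ⟨(x, y), by simpa [mem_edgeList] using ⟨hlt, hadj⟩, rfl⟩
      · exact absurd hadj G.irrefl
      · exact ⟨(y, x), by simpa [mem_edgeList] using ⟨hlt, hadj.symm⟩, Sym2.eq_swap⟩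
  · intro e _
    have hex : (∃ v ∈ S, v ∈ s(e.1, e.2)) ↔ e.1 ∈ S ∨ e.2 ∈ S := by
      simp only [Sym2.mem_iff]
      constructor
      · rintro ⟨v, hv, rfl | rfl⟩
        · exact Or.inl hv
        · exact Or.inr hv
      · rintro (h | h)
        · exact ⟨_, h, Or.inl rfl⟩
        · exact ⟨_, h, Or.inr rfl⟩
    simp only [hex]
    by_cases h1 : e.1 ∈ S <;> by_cases h2 : e.2 ∈ S <;> simp [endpointsIn, h1, h2, coverCoeff]

theorem endpointsIn_mono (e : Fin n × Fin n) {X Y : Finset (Fin n)} (h : X ⊆ Y) :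
    endpointsIn e X ≤ endpointsIn e Y := by
  unfold endpointsIn
  have h1 := @h e.1
  have h2 := @h e.2
  split_ifs <;> simp_all

theorem potentialCoeff_mono {k l : ℕ} (h : k ≤ l) : (potentialCoeff k : ℝ) ≤ potentialCoeff l := by
  rcases k with _ | _ | k <;> rcases l with _ | _ | l <;> norm_num [potentialCoeff] <;> omega

theorem edgeValue_mono {L : List (Fin n × Fin n)} (hw : ∀ e ∈ L, 0 ≤ w s(e.1, e.2))
    {X Y : Finset (Fin n)} (h : X ⊆ Y) :
    edgeValue potentialCoeff w L X ≤ edgeValue potentialCoeff w L Y :=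
  List.sum_le_sum fun e he =>
    mul_le_mul_of_nonneg_right (potentialCoeff_mono (endpointsIn_mono e h)) (hw e he)

/-- Without loops a singleton meets an edge at most once, so the right side counts each edge once
per endpoint in X. It is used for the potential to bound the rounds, and for coverage to show that
the best vertex of O has a 1/n share. -/
theorem edgeValue_le_sum_singleton {a : ℕ → ℚ} (ha : ∀ k, a k ≤ k) (ha0 : a 0 = 0) (ha1 : a 1 = 1)
    {L : List (Fin n × Fin n)} (hw : ∀ e ∈ L, 0 ≤ w s(e.1, e.2)) (hL : ∀ e ∈ L, e.1 ≠ e.2)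
    (X : Finset (Fin n)) : edgeValue a w L X ≤ ∑ x ∈ X, edgeValue a w L {x} := by
  induction L with
  | nil => simp [edgeValue]
  | cons e L ih =>
    have ih' := ih (fun e he => hw e (List.mem_cons_of_mem _ he))
      (fun e he => hL e (List.mem_cons_of_mem _ he))
    simp only [edgeValue, List.map_cons, List.sum_cons] at ih' ⊢
    rw [Finset.sum_add_distrib, ← Finset.sum_mul]
    refine add_le_add (mul_le_mul_of_nonneg_right ?_ (hw e (by simp))) ih'
    have hne := hL e (by simp)
    have h1 : ∀ x : Fin n, (a (endpointsIn e {x}) : ℝ) =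
        (if e.1 = x then 1 else 0) + (if e.2 = x then 1 else 0) := by
      intro x
      by_cases h1 : e.1 = x <;> by_cases h2 : e.2 = x
      · exact absurd (h1.trans h2.symm) hne
      all_goals simp [endpointsIn, h1, h2, ha0, ha1]
    rw [Finset.sum_congr rfl fun x _ => h1 x, Finset.sum_add_distrib, Finset.sum_ite_eq,
      Finset.sum_ite_eq]
    have h2 : (a (endpointsIn e X) : ℝ) ≤ (endpointsIn e X : ℝ) := by exact_mod_cast ha _
    refine h2.trans (le_of_eq ?_)
    simp [endpointsIn]

/-- Edges at v are covered by v whatever T is; this separates the guessed vertex from the residual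
instance. -/
theorem cover_insert (L : List (Fin n × Fin n)) (v : Fin n) (T : Finset (Fin n)) :
    edgeValue coverCoeff w L (insert v T) = edgeValue coverCoeff w L {v} +
      edgeValue coverCoeff w (L.filter fun e => e.1 ≠ v ∧ e.2 ≠ v) T := by
  induction L with
  | nil => simp [edgeValue]
  | cons e L ih =>
    simp only [edgeValue, List.map_cons, List.sum_cons, List.filter_cons] at ih ⊢
    rw [ih]
    by_cases h1 : e.1 = v <;> by_cases h2 : e.2 = v <;>
      simp [endpointsIn, h1, h2, coverCoeff]
    all_goals ring

end Edges

/-! ### Assembling the ratio and the running time. -/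

/-- Here x is the coverage of v, while t and o are the residual values of the local optimum and of
O. With ε = 1/(3n)² the error is t/(6n). If t ≤ 3nx it is at most x/2, the surplus from counting x
with factor 3/2; otherwise x + o ≤ nx < t/3 already suffices. -/
theorem approximation_arithmetic {p n : ℕ} (hp : 1 ≤ p) (hn : 0 < n) {x t o S : ℝ} (hx : 0 ≤ x)
    (ht : 0 ≤ t) (hnx : x + o ≤ n * x)
    (ho : o ≤ 3 / 2 * (1 + 1 / (p : ℝ)) * t + n * (1 / (3 * (n : ℝ)) ^ 2 * (3 / 2 * t)))
    (hS : x + t ≤ S) : 2 / 3 * (1 - 1 / ((p : ℝ) + 1)) * (x + o) ≤ S := by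
  have hp0 : (0 : ℝ) < p := by exact_mod_cast hp
  have hn0 : (0 : ℝ) < n := by exact_mod_cast hn
  have hδ : 0 < 1 / (p : ℝ) := by positivity
  have e1 : (n : ℝ) * (1 / (3 * (n : ℝ)) ^ 2 * (3 / 2 * t)) = t / (6 * n) := by
    field_simp; ring
  rw [e1] at ho
  have key : x + o ≤ 3 / 2 * (1 + 1 / (p : ℝ)) * (x + t) := by
    have h1 : 0 ≤ 1 / (p : ℝ) * x := by positivity
    have h2 : 0 ≤ 1 / (p : ℝ) * t := by positivity
    rcases le_or_gt t (3 * n * x) with h | h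
    · have : t / (6 * n) ≤ x / 2 := by
        rw [div_le_div_iff₀ (by positivity) (by norm_num)]
        linarith
      linarith
    · linarith
  have hρ : 0 ≤ 2 / 3 * (1 - 1 / ((p : ℝ) + 1)) := by
    have : 1 / ((p : ℝ) + 1) ≤ 1 := by rw [div_le_one (by linarith)]; linarith
    linarith
  have e2 : 2 / 3 * (1 - 1 / ((p : ℝ) + 1)) * (3 / 2 * (1 + 1 / (p : ℝ)) * (x + t)) = x + t := by
    field_simp; ring
  exact (mul_le_mul_of_nonneg_left key hρ).trans (e2.le.trans hS)

theorem running_time_bound {n N p : ℕ} (hp : 1 ≤ p) (hN : 2 ≤ N) (hn : n ≤ N) :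
    n * (2 + (((n + 1) * (n * (2 + (1 + n ^ 2 * 3 + 1))) + (9 * n ^ 3 + 1) *
      (1 + (1 + n ^ 2 * 3 + (1 + N ^ (4 * p + 3) * (2 + (1 + n ^ 2 * 3 + 1)))))) +
      (1 + n ^ 2 * 3 + (1 + n ^ 2 * 3 + (1 + 0))))) ≤ N ^ (22 * p) := by
  have hn2 : n ^ 2 ≤ N ^ 2 := Nat.pow_le_pow_left hn 2
  have hn3 : n ^ 3 ≤ N ^ 3 := Nat.pow_le_pow_left hn 3
  have h1 : n + 1 ≤ N ^ 2 := by nlinarith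
  have h4 : 4 + n ^ 2 * 3 ≤ N ^ 4 := by
    have : 4 ≤ N ^ 2 := by nlinarith
    nlinarith
  have h7 : 9 * n ^ 3 + 1 ≤ N ^ 7 := by
    have h16 : 2 ^ 4 ≤ N ^ 4 := Nat.pow_le_pow_left hN 4
    have h8 : 1 ≤ N ^ 3 := Nat.one_le_pow _ _ (by omega)
    calc 9 * n ^ 3 + 1 ≤ N ^ 3 * 2 ^ 4 := by omega
      _ ≤ N ^ 3 * N ^ 4 := Nat.mul_le_mul_left _ h16
      _ = N ^ 7 := by ring
  have dbl : ∀ k, N ^ k + N ^ k ≤ N ^ (k + 1) := fun k => by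
    rw [pow_succ]; have := Nat.mul_le_mul_left (N ^ k) hN; omega
  have pm : ∀ {k l}, k ≤ l → N ^ k ≤ N ^ l := fun h => Nat.pow_le_pow_right (by omega) h
  have hA : (n + 1) * (n * (2 + (1 + n ^ 2 * 3 + 1))) ≤ N ^ 7 := by
    calc _ ≤ N ^ 2 * (N * N ^ 4) :=
          Nat.mul_le_mul h1 (Nat.mul_le_mul hn (by omega))
      _ = N ^ 7 := by ring
  have hB : N ^ (4 * p + 3) * (2 + (1 + n ^ 2 * 3 + 1)) ≤ N ^ (4 * p + 7) := by
    calc _ ≤ N ^ (4 * p + 3) * N ^ 4 := Nat.mul_le_mul_left _ (by omega)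
      _ = N ^ (4 * p + 7) := by rw [← pow_add]
  have hC : 1 + (1 + n ^ 2 * 3 + (1 + N ^ (4 * p + 3) * (2 + (1 + n ^ 2 * 3 + 1)))) ≤
      N ^ (4 * p + 8) := by
    have : _ ≤ N ^ (4 * p + 8) := dbl (4 * p + 7)
    have := pm (show 4 ≤ 4 * p + 7 by omega)
    omega
  have hD : (9 * n ^ 3 + 1) *
      (1 + (1 + n ^ 2 * 3 + (1 + N ^ (4 * p + 3) * (2 + (1 + n ^ 2 * 3 + 1))))) ≤
      N ^ (4 * p + 15) := by
    calc _ ≤ N ^ 7 * N ^ (4 * p + 8) := Nat.mul_le_mul h7 hC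
      _ = N ^ (4 * p + 15) := by rw [← pow_add]; congr 1; omega
  have hE : _ ≤ N ^ (4 * p + 16) := dbl (4 * p + 15)
  have hF : _ ≤ N ^ (4 * p + 17) := dbl (4 * p + 16)
  have hG := pm (show 7 ≤ 4 * p + 15 by omega)
  have hH : _ ≤ N ^ 5 := dbl 4
  have hI := pm (show 5 ≤ 4 * p + 16 by omega)
  calc _ ≤ N * N ^ (4 * p + 17) := Nat.mul_le_mul hn (by omega)
    _ = N ^ (4 * p + 18) := by rw [← pow_succ']
    -- Since p ≥ 1, the exponent 4p + 18 is at most 22p; this fixes the constant C = 22.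
    _ ≤ N ^ (22 * p) := pm (by omega)

theorem spec_twoMatroidSearch {n : ℕ} {p : ℕ} (hp : 1 ≤ p) (G : SimpleGraph (Fin n))
    [DecidableRel G.Adj] {w : Sym2 (Fin n) → ℝ} (hw : ∀ e ∈ G.edgeSet, 0 ≤ w e)
    (M₁ M₂ : Matroid (Fin n)) :
    Spec M₁ M₂ (twoMatroidSearch p G w) ((max n 2) ^ (22 * p)) (fun S =>
      M₁.Indep (S : Set (Fin n)) ∧ M₂.Indep (S : Set (Fin n)) ∧
      ∀ O : Finset (Fin n), M₁.Indep (O : Set (Fin n)) → M₂.Indep (O : Set (Fin n)) →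
        2 / 3 * (1 - 1 / ((p : ℝ) + 1)) * coveredWeight G w O ≤ coveredWeight G w S) := by
  set N := max n 2 with hNdef
  have hnN : n ≤ N := le_max_left _ _
  have hN2 : 2 ≤ N := le_max_right _ _
  have hwL : ∀ e ∈ edgeList G, 0 ≤ w s(e.1, e.2) := fun e he => hw _ (mem_edgeList.1 he).2
  have hLne : ∀ e ∈ edgeList G, e.1 ≠ e.2 := fun e he => (mem_edgeList.1 he).1.ne
  have hlen := length_edgeList_le G
  set verts : Fin n → List (Fin n) := fun v => (List.finRange n).filter (· ≠ v) with hverts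
  set edges : Fin n → List (Fin n × Fin n) :=
    fun v => (edgeList G).filter fun e => e.1 ≠ v ∧ e.2 ≠ v with hedges
  have hmemv : ∀ v x, x ∈ verts v ↔ x ≠ v := fun v x => by simp [hverts]
  have hwE : ∀ v, ∀ e ∈ edges v, 0 ≤ w s(e.1, e.2) :=
    fun v e he => hwL e (List.mem_of_mem_filter he)
  have hvlen : ∀ v, (verts v).length ≤ n :=
    fun v => (List.length_filter_le _ _).trans (by simp)
  -- The invariant only records, for each processed feasible v, a local optimum dominated by the
  -- current best. The comparison with O is left until the right v is known.
  refine (Spec.foldlM (P := fun l (S : Finset (Fin n)) => M₁.Indep (S : Set (Fin n)) ∧ M₂.Indep (S : Set (Fin n)) ∧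
    ∀ v ∈ l, M₁.Indep (({v} : Finset (Fin n)) : Set (Fin n)) →
      M₂.Indep (({v} : Finset (Fin n)) : Set (Fin n)) → ∃ T : Finset (Fin n),
      M₁.Indep (insert v T : Finset (Fin n)) ∧ M₂.Indep (insert v T : Finset (Fin n)) ∧ v ∉ T ∧
      (∀ X ∈ exchanges p (verts v) T, M₁.Indep (insert v X : Finset (Fin n)) →
        M₂.Indep (insert v X : Finset (Fin n)) → edgeValue potentialCoeff w (edges v) X ≤
          (1 + 1 / (3 * (n : ℝ)) ^ 2) * edgeValue potentialCoeff w (edges v) T) ∧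
      edgeValue coverCoeff w (edgeList G) (insert v T) ≤ edgeValue coverCoeff w (edgeList G) S)
    (t := 2 + (((n + 1) * (n * (2 + (1 + n ^ 2 * 3 + 1))) + (9 * n ^ 3 + 1) *
      (1 + (1 + n ^ 2 * 3 + (1 + N ^ (4 * p + 3) * (2 + (1 + n ^ 2 * 3 + 1)))))) +
      (1 + n ^ 2 * 3 + (1 + n ^ 2 * 3 + (1 + 0)))))
    (List.finRange n) ?_ [] ∅ ⟨by simp, by simp, by simp⟩).mono
    (by rw [List.length_finRange]; exact running_time_bound hp hN2 hnN) ?_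
  · rintro l v best - ⟨hb₁, hb₂, hb⟩
    have hn0 : 0 < n := Fin.pos v
    have hn0' : (0 : ℝ) < n := by exact_mod_cast hn0
    have hn0'' : (0 : ℚ) < n := by exact_mod_cast hn0
    refine Spec.bind (spec_commonIndep {v}) fun c hc => ?_
    split_ifs with h
    · obtain ⟨hv₁, hv₂⟩ := hc.1 h
      -- The choice K = 9n³ makes Kε equal to n.
      have hls := spec_localSearch (M₁ := M₁) (M₂ := M₂) (p := p) (verts := verts v)
        (tf := 2) (tg := 1 + n ^ 2 * 3) (D := N ^ (4 * p + 3)) (K := 9 * n ^ 3)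
        (ε := 1 / (3 * (n : ℚ)) ^ 2)
        (feasible := fun X => commonIndep (insert v X))
        (g := edgeSum potentialCoeff w (edges v)) (gv := edgeValue potentialCoeff w (edges v))
        (F := fun X => M₁.Indep (insert v X : Finset (Fin n)) ∧
          M₂.Indep (insert v X : Finset (Fin n)))
        (fun X => spec_commonIndep (insert v X))
        (fun X => (spec_edgeSum potentialCoeff w (edges v) X).mono (by
          have : (edges v).length ≤ n ^ 2 := (List.length_filter_le _ _).trans hlen
          omega) fun _ h => h)
        (fun X Y hXY => edgeValue_mono (hwE v) hXY)
        (edgeValue_nonneg potentialCoeff_nonneg (hwE v))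
        (edgeValue_le_sum_singleton (by
            rintro (_ | _ | k)
            · simp [potentialCoeff]
            · simp [potentialCoeff]
            · simp only [potentialCoeff]; push_cast
              have : (0 : ℚ) ≤ k := Nat.cast_nonneg k
              linarith) rfl rfl (hwE v)
          fun e he => hLne e (List.mem_of_mem_filter he))
        (by simpa only [LawfulSingleton.insert_empty_eq] using And.intro hv₁ hv₂)
        (fun X Y hXY hY => ⟨hY.1.subset (by exact_mod_cast Finset.insert_subset_insert v hXY),
          hY.2.subset (by exact_mod_cast Finset.insert_subset_insert v hXY)⟩)
        (by positivity) (length_exchanges_le hN2 p ((hvlen v).trans hnN))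
        (fun S hS X hX x hx => subset_of_mem_exchanges hS hX hx)
        (by
          push_cast
          refine le_of_eq ?_
          field_simp
          norm_num)
      refine Spec.bind (hls.mono (Nat.add_le_add_right (Nat.mul_le_mul_left _
        (Nat.mul_le_mul_right _ (hvlen v))) _) fun _ h => h) fun T hT => ?_
      obtain ⟨⟨hT₁, hT₂⟩, hTv, hTloc⟩ := hT
      have hE : ∀ X, Spec M₁ M₂ (edgeSum coverCoeff w (edgeList G) X) (1 + n ^ 2 * 3)
          (· = edgeValue coverCoeff w (edgeList G) X) := fun X =>
        (spec_edgeSum coverCoeff w (edgeList G) X).mono (by omega) fun _ h => h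
      have hout : ∀ S : Finset (Fin n), edgeValue coverCoeff w (edgeList G) (insert v T) ≤
          edgeValue coverCoeff w (edgeList G) S → ∃ T : Finset (Fin n),
          M₁.Indep (insert v T : Finset (Fin n)) ∧ M₂.Indep (insert v T : Finset (Fin n)) ∧ v ∉ T ∧
          (∀ X ∈ exchanges p (verts v) T, M₁.Indep (insert v X : Finset (Fin n)) →
            M₂.Indep (insert v X : Finset (Fin n)) → edgeValue potentialCoeff w (edges v) X ≤
              (1 + 1 / (3 * (n : ℝ)) ^ 2) * edgeValue potentialCoeff w (edges v) T) ∧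
          edgeValue coverCoeff w (edgeList G) (insert v T) ≤
            edgeValue coverCoeff w (edgeList G) S := fun S hS =>
        ⟨T, hT₁, hT₂, fun h => (hmemv v v).1 (hTv v h) rfl, fun X hX h₁ h₂ => by
          have := hTloc X hX ⟨h₁, h₂⟩
          push_cast at this
          exact this, hS⟩
      refine Spec.bind (hE best) fun x hx => Spec.bind (hE (insert v T)) fun y hy =>
        Spec.bind (Spec.less x y) fun c' hc' => ?_
      rw [hx, hy] at hc'
      split_ifs with h'
      · refine Spec.pure ⟨hT₁, hT₂, fun u hu hu₁ hu₂ => ?_⟩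
        rcases List.mem_append.1 hu with hu | hu
        · obtain ⟨T', h1, h2, h3, h4, h5⟩ := hb u hu hu₁ hu₂
          exact ⟨T', h1, h2, h3, h4, h5.trans (hc'.1 h').le⟩
        · rw [List.mem_singleton.1 hu]
          exact hout _ le_rfl
      · refine Spec.pure ⟨hb₁, hb₂, fun u hu hu₁ hu₂ => ?_⟩
        rcases List.mem_append.1 hu with hu | hu
        · exact hb u hu hu₁ hu₂
        · rw [List.mem_singleton.1 hu]
          exact hout _ (not_lt.1 fun hlt => h' (hc'.2 hlt))
    · refine Spec.pure ⟨hb₁, hb₂, fun u hu hu₁ hu₂ => ?_⟩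
      rcases List.mem_append.1 hu with hu | hu
      · exact hb u hu hu₁ hu₂
      · obtain rfl := List.mem_singleton.1 hu
        exact absurd (hc.2 ⟨hu₁, hu₂⟩) h
  · rintro S ⟨hS₁, hS₂, hS⟩
    refine ⟨hS₁, hS₂, fun O hO₁ hO₂ => ?_⟩
    rw [coveredWeight_eq_edgeValue, coveredWeight_eq_edgeValue]
    have hcov0 : ∀ X, 0 ≤ edgeValue coverCoeff w (edgeList G) X :=
      edgeValue_nonneg coverCoeff_nonneg hwL
    rcases O.eq_empty_or_nonempty with rfl | hO
    · have : edgeValue coverCoeff w (edgeList G) ∅ = 0 := by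
        simp [edgeValue, endpointsIn, coverCoeff]
      rw [this, mul_zero]
      exact hcov0 S
    -- Only the run for the vertex of O with largest individual coverage is analysed; by
    -- subadditivity that coverage is at least a 1/n fraction of the coverage of O.
    obtain ⟨v, hvO, hvmax⟩ := O.exists_max_image
      (fun v => edgeValue coverCoeff w (edgeList G) {v}) hO
    have hsub : (({v} : Finset (Fin n)) : Set (Fin n)) ⊆ O := by simpa using hvO
    obtain ⟨T, hT₁, hT₂, hvT, hloc, hTS⟩ := hS v (by simp) (hO₁.subset hsub) (hO₂.subset hsub)
    have hins : insert v (O.erase v) = O := Finset.insert_erase hvO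
    have hOv := cover_insert (w := w) (edgeList G) v (O.erase v)
    rw [hins] at hOv
    rw [cover_insert] at hTS
    have hsum : edgeValue coverCoeff w (edgeList G) O ≤
        n * edgeValue coverCoeff w (edgeList G) {v} := by
      calc _ ≤ ∑ x ∈ O, edgeValue coverCoeff w (edgeList G) {x} :=
            edgeValue_le_sum_singleton (by
              rintro (_ | k)
              · simp [coverCoeff]
              · simp [coverCoeff]) rfl rfl hwL hLne O
        _ ≤ ∑ _x ∈ O, edgeValue coverCoeff w (edgeList G) {v} := Finset.sum_le_sum hvmax
        _ = O.card * edgeValue coverCoeff w (edgeList G) {v} := by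
            rw [Finset.sum_const, nsmul_eq_mul]
        _ ≤ n * edgeValue coverCoeff w (edgeList G) {v} :=
            mul_le_mul_of_nonneg_right (by exact_mod_cast card_finset_fin_le O) (hcov0 _)
    have hmain := cover_le_of_local_optimum (hwE v) hvT (Finset.notMem_erase v O) hT₁ hT₂
      (by rwa [hins]) (by rwa [hins]) hp (ε := 1 / (3 * (n : ℝ)) ^ 2) (by positivity)
      (fun A hA B hBT hvB hAc hBc h₁ h₂ => hloc _ (mem_exchanges
        ((List.nodup_finRange n).filter _)
        (fun x hx => (hmemv v x).2 fun h => hvT (h ▸ hx)) hA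
        (fun x hx => (hmemv v x).2 fun h => hvB (h ▸ hx)) hBT hAc hBc) h₁ h₂)
    rw [hOv] at hsum ⊢
    exact approximation_arithmetic hp (Fin.pos v) (hcov0 _)
      (edgeValue_nonneg coverCoeff_nonneg (hwE v) T) hsum hmain hTS

end MatroidCover

theorem mainTheorem5 :
    ∃ C : ℕ, ∀ (p : ℕ), 1 ≤ p → ∀ (n : ℕ) (G : SimpleGraph (Fin n)) [DecidableRel G.Adj]
      (w : Sym2 (Fin n) → ℝ), (∀ e ∈ G.edgeSet, 0 ≤ w e) →
      ∀ (M₁ M₂ : Matroid (Fin n)), M₁.E = Set.univ → M₂.E = Set.univ →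
      ∃ r ∈ (MatroidCover.twoMatroidSearch p G w).run M₁ M₂,
        M₁.Indep (r.val : Set (Fin n)) ∧ M₂.Indep (r.val : Set (Fin n)) ∧
        (∀ O : Finset (Fin n), M₁.Indep (O : Set (Fin n)) → M₂.Indep (O : Set (Fin n)) →
          2 / 3 * (1 - 1 / ((p : ℝ) + 1)) * MatroidCover.coveredWeight G w O
            ≤ MatroidCover.coveredWeight G w r.val) ∧
        r.ops ≤ (max n 2) ^ (C * p) ∧ r.calls ≤ (max n 2) ^ (C * p) := by
  refine ⟨22, fun p hp n G _ w hw M₁ M₂ _ _ => ?_⟩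
  obtain ⟨r, hr, ⟨h₁, h₂, h₃⟩, hops, hcalls⟩ := MatroidCover.spec_twoMatroidSearch hp G hw M₁ M₂
  exact ⟨r, hr, h₁, h₂, h₃, hops, hcalls⟩
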